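/- Let $\mathbb F$ be a field and let $0\neq q\in\mathbb F$ be not a root of unity. Write $[X,Y]=XY-YX$ and $[X,Y]_p=pXY-p^{-1}YX$. The $q$-Onsager algebra $\mathcal O_q$ is the associative unital $\mathbb F$-algebra with generators $A,A^*$ and relations $$[A,[A,[A,A^*]_q]_{q^{-1}}]=(q^2-q^{-2})^2[A^*,A],\qquad [A^*,[A^*,[A^*,A]_q]_{q^{-1}}]=(q^2-q^{-2})^2[A,A^*].$$ Let $$L(A^*)=A^*+\frac{[A,[A,A^*]_q]}{(q-q^{-1})(q^2-q^{-2})}\in\mathcal O_q$$ (the image of $A^*$ under the Lusztig automorphism $L$ of $\mathcal O_q$). Let $V$ be an irreducible $\mathcal O_q$-module, of finite dimension at least $2$ over $\mathbb F$, on which each of $A,A^*$ is diagonalizable. Conventions. For $d\in\mathbb N$, a decomposition of $V$ is a sequence $W=\{W_i\}_{i=0}^d$ of nonzero subspaces whose direct sum is $V$; its inversion is $W^{\rm inv}=\{W_{d-i}\}_{i=0}^d$. Two sequences $W,W'$ have a common corner if $W_0+\cdots+W_i=W'_0+\cdots+W'_i$ for $0\le i\le d$. For sequences $X,Y$ of subspaces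 and $M\in{\rm End}(V)$ we write $X\xrightarrow{\;M\;}Y$ if $M$ is diagonalizable with eigenvalues $\{q^{d-2i}\}_{i=0}^d$ and, with $W_i$ the eigenspace of $M$ for $q^{d-2i}$, the decomposition $W$ has a common corner with $X$ and $W^{\rm inv}$ has a common corner with $Y$. Theorem. There is an integer $d\ge1$ such that the eigenvalues of $A$ on $V$ can be ordered as $\theta_0,\dots,\theta_d$ (without repetition) so that $\theta_{i-1}\ne\theta_i$ and $$\theta_{i-1}^2-(q^2+q^{-2})\theta_{i-1}\theta_i+\theta_i^2+(q^2-q^{-2})^2=0\qquad(1\le i\le d),$$ and the eigenvalues of $A^*$ on $V$ can be ordered as $\theta^*_0,\dots,\theta^*_d$ (without repetition) so that the eigenspaces $V^*_i$ of $A^*$ for $\theta^*_i$ satisfy $AV^*_i\subseteq V^*_{i-1}+V^*_i+V^*_{i+1}$ $(0\le i\le d$, $V^*_{-1}=V^*_{d+1}=0)$. For all such orderings, let $\mathbf V=\{V_i\}$, $\mathbf V^*=\{V^*_i\}$, $\mathbf V^+=\{V^+_i\}$ be the sequences of eigenspaces of $A$ for $\theta_i$, of $A^*$ for $\theta^*_i$,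 and of $L(A^*)$ for $\theta^*_i$ $(0\le i\le d)$. Then: 1. There is $0\ne a\in\mathbb F$ with $\theta_i=aq^{d-2i}+a^{-1}q^{2i-d}$ for $0\le i\le d$. 2. $\mathbf V$, $\mathbf V^*$, $\mathbf V^+$ are decompositions of $V$. 3. There are unique invertible $K,B,K^\downarrow,B^\downarrow\in{\rm End}(V)$ with $$\mathbf V^*\xrightarrow{K}\mathbf V^{\rm inv},\qquad \mathbf V^*\xrightarrow{B}\mathbf V,\qquad (\mathbf V^*)^{\rm inv}\xrightarrow{K^\downarrow}\mathbf V^{\rm inv},\qquad (\mathbf V^*)^{\rm inv}\xrightarrow{B^\downarrow}\mathbf V .$$ 4. For any $a$ as in 1, $$\mathbf V^+\xrightarrow{\;aA-a^2B^{-1}\;}\mathbf V,\qquad \mathbf V^+\xrightarrow{\;a^{-1}A-a^{-2}K^{-1}\;}\mathbf V^{\rm inv},$$ $$(\mathbf V^+)^{\rm inv}\xrightarrow{\;aA-a^2(B^\downarrow)^{-1}\;}\mathbf V,\qquad (\mathbf V^+)^{\rm inv}\xrightarrow{\;a^{-1}A-a^{-2}(K^\downarrow)^{-1}\;}\mathbf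 V^{\rm inv}.$$ 5. For any $a$ as in 1, $a^{-1}-a\neq0$, and the maps $$N=\frac{a^{-1}K^{-1}-aB^{-1}}{a^{-1}-a},\qquad N^\downarrow=\frac{a^{-1}(K^\downarrow)^{-1}-a(B^\downarrow)^{-1}}{a^{-1}-a}$$ satisfy $$\mathbf V^+\xrightarrow{\;N\;}\mathbf V^*,\qquad (\mathbf V^+)^{\rm inv}\xrightarrow{\;N^\downarrow\;}(\mathbf V^*)^{\rm inv}.$$ In particular $N$ and $N^\downarrow$ are diagonalizable with eigenvalues $\{q^{d-2i}\}_{i=0}^d$. -/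

import Mathlib

noncomputable section

namespace QOns

universe u v

/-- The two free generators. -/
inductive Gen : Type
  | A
  | Astar

/-- The commutator `[X, Y] = XY - YX`. -/
def bracket {R : Type*} [Ring R] (X Y : R) : R := X * Y - Y * X

/-- The `p`-commutator `[X, Y]_p = p XY - p⁻¹ YX`. -/
def qBracket {F : Type*} [Field F] {R : Type*} [Ring R] [Algebra F R] (p : F) (X Y : R) : R :=
  p • (X * Y) - p⁻¹ • (Y * X)

/-- The `q`-Dolan/Grady relations, on the free algebra with generators `A`, `A*`. -/
inductive DolanGrady (F : Type u) [Field F] (q : F) :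
    FreeAlgebra F Gen → FreeAlgebra F Gen → Prop
  | rel_one : DolanGrady F q
      (bracket (FreeAlgebra.ι F Gen.A) (qBracket q⁻¹ (FreeAlgebra.ι F Gen.A)
        (qBracket q (FreeAlgebra.ι F Gen.A) (FreeAlgebra.ι F Gen.Astar))))
      ((q ^ 2 - q⁻¹ ^ 2) ^ 2 • bracket (FreeAlgebra.ι F Gen.Astar) (FreeAlgebra.ι F Gen.A))
  | rel_two : DolanGrady F q
      (bracket (FreeAlgebra.ι F Gen.Astar) (qBracket q⁻¹ (FreeAlgebra.ι F Gen.Astar)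
        (qBracket q (FreeAlgebra.ι F Gen.Astar) (FreeAlgebra.ι F Gen.A))))
      ((q ^ 2 - q⁻¹ ^ 2) ^ 2 • bracket (FreeAlgebra.ι F Gen.A) (FreeAlgebra.ι F Gen.Astar))

/-- The `q`-Onsager algebra `O_q`: generators `A`, `A*` and the `q`-Dolan/Grady relations. -/
abbrev QOnsager (F : Type u) [Field F] (q : F) : Type u := RingQuot (DolanGrady F q)

/-- The generator `A` of `O_q`. -/
def genA (F : Type u) [Field F] (q : F) : QOnsager F q :=
  RingQuot.mkAlgHom F (DolanGrady F q) (FreeAlgebra.ι F Gen.A)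

/-- The generator `A*` of `O_q`. -/
def genAstar (F : Type u) [Field F] (q : F) : QOnsager F q :=
  RingQuot.mkAlgHom F (DolanGrady F q) (FreeAlgebra.ι F Gen.Astar)

/-- The element `L(A*) = A* + [A, [A, A*]_q] / ((q - q⁻¹)(q² - q⁻²))` of `O_q`, the image of `A*`
under the Lusztig automorphism `L` (and `L(A) = A`). -/
def lusztigAstar (F : Type u) [Field F] (q : F) : QOnsager F q :=
  genAstar F q + ((q - q⁻¹) * (q ^ 2 - q⁻¹ ^ 2))⁻¹ •
    bracket (genA F q) (qBracket q (genA F q) (genAstar F q))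

/-- The action of an element of `O_q` on an `O_q`-module `V`, as an element of `End(V)`. -/
def act {F : Type u} [Field F] {q : F} (V : Type v) [AddCommGroup V] [Module F V]
    [Module (QOnsager F q) V] [IsScalarTower F (QOnsager F q) V] (x : QOnsager F q) :
    Module.End F V :=
  Algebra.lsmul F F V x

section Decompositions

variable {F : Type u} [Field F] {V : Type v} [AddCommGroup V] [Module F V]

/-- `V` is spanned by eigenvectors of `f`. -/
def Diagonalizable (f : Module.End F V) : Prop :=
  ⨆ μ : F, f.eigenspace μ = ⊤

/-- `x`, `y` are adjacent: `x ≠ y` and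
`P(x, y) = x² - (q² + q⁻²) xy + y² + (q² - q⁻²)²` vanishes. -/
def Adjacent (q x y : F) : Prop :=
  x ≠ y ∧
    x ^ 2 - (q ^ 2 + q⁻¹ ^ 2) * x * y + y ^ 2 + (q ^ 2 - q⁻¹ ^ 2) ^ 2 = 0

/-- `θ_0, …, θ_d` is an ordering, without repetition, of the set of eigenvalues of `f`. -/
def IsEigenvalueOrdering {d : ℕ} (f : Module.End F V) (θ : Fin (d + 1) → F) : Prop :=
  Function.Injective θ ∧ ∀ x : F, f.HasEigenvalue x ↔ x ∈ Set.range θ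

/-- The eigenspaces `V_0, …, V_d` of `f` for `θ_0, …, θ_d`. -/
def eigenspaces {d : ℕ} (f : Module.End F V) (θ : Fin (d + 1) → F) :
    Fin (d + 1) → Submodule F V :=
  fun i => f.eigenspace (θ i)

/-- `g W_i ⊆ W_{i-1} + W_i + W_{i+1}` for `0 ≤ i ≤ d`, where `W_{-1} = W_{d+1} = 0`. -/
def ThreeTerm {d : ℕ} (g : Module.End F V) (W : Fin (d + 1) → Submodule F V) : Prop :=
  ∀ i : Fin (d + 1), (W i).map g ≤
    ⨆ (j : Fin (d + 1)) (_ : (j : ℕ) ≤ (i : ℕ) + 1 ∧ (i : ℕ) ≤ (j : ℕ) + 1), W j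

/-- A decomposition of `V`: a sequence of nonzero subspaces whose direct sum is `V`. -/
def IsDecomposition {d : ℕ} (W : Fin (d + 1) → Submodule F V) : Prop :=
  (∀ i, W i ≠ ⊥) ∧ DirectSum.IsInternal W

/-- The inversion `W_d, …, W_0` of `W_0, …, W_d`. -/
def inversion {d : ℕ} (W : Fin (d + 1) → Submodule F V) : Fin (d + 1) → Submodule F V :=
  fun i => W i.rev

/-- `W_0 + ⋯ + W_i = W'_0 + ⋯ + W'_i` for `0 ≤ i ≤ d`: the condition that is drawn by two line
segments with a common endpoint, at which both sequences start. -/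
def SameFlag {d : ℕ} (W W' : Fin (d + 1) → Submodule F V) : Prop :=
  ∀ i : Fin (d + 1), ⨆ (j : Fin (d + 1)) (_ : j ≤ i), W j = ⨆ (j : Fin (d + 1)) (_ : j ≤ i), W' j

/-- The eigenspaces of `M` for the eigenvalues `q^d, q^(d-2), …, q^(-d)`, in this order. -/
def weightSpaces (q : F) (d : ℕ) (M : Module.End F V) : Fin (d + 1) → Submodule F V :=
  fun i => M.eigenspace (q ^ ((d : ℤ) - 2 * ((i : ℕ) : ℤ)))

/-- The arrow labelled `M` from the endpoint at which the decomposition `X` starts to the endpoint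
at which the decomposition `Y` starts: `M` is diagonalizable with eigenvalues `q^(d-2i)`
(`0 ≤ i ≤ d`), and its eigenspace decomposition `W_0, …, W_d`, where `W_i` belongs to `q^(d-2i)`,
satisfies `W_0 + ⋯ + W_i = X_0 + ⋯ + X_i` and `W_d + ⋯ + W_{d-i} = Y_0 + ⋯ + Y_i`. -/
structure IsArrow (q : F) {d : ℕ} (M : Module.End F V) (X Y : Fin (d + 1) → Submodule F V) :
    Prop where
  decomposition : IsDecomposition (weightSpaces q d M)
  source : SameFlag (weightSpaces q d M) X
  target : SameFlag (inversion (weightSpaces q d M)) Y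

end Decompositions

end QOns

end

/-! The module is used only through the operators `A`, `A*`: they satisfy the two Dolan/Grady
relations and have no common invariant subspace except `0` and `V`.

The Lusztig automorphism is inner on `V`. There is an invertible `H`, scalar `t_n = a^(-2n)
q^(2n(n-d))` on `V_n`, with `HA = AH` and `HA* = L(A*)H` (`exists_lusztig_conjugation`). So `H`
fixes each `V_n` and carries `V*_i` to `V+_i`, and the arrow from `V+` to `V` must be `H B H⁻¹`. The
point is that this equals `aA - a²B⁻¹`. Let `U_n` be the eigenspace of `B` for `s_n = q^(2n-d)`.
Since `A - θ_n` sends `U_n` into `U_(n-1)`, one can expand `Hx = ∑ c_k w_k` for `x ∈ U_n`, with `w_k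
= (A - θ_(n-k+1)) ⋯ (A - θ_n) x ∈ U_(n-k)` (`conjugation_eq_sum`). From `θ_m = a s_m⁻¹ + a⁻¹ s_m`,
the operator `aA - a²B⁻¹` sends `w_k` to `s_(n-k) w_k + a w_(k+1)`, and `c_(k+1) (s_n - s_(n-k-1)) =
a c_k` makes `Hx` an eigenvector for `s_n`. Reversing `V` replaces `a` by `a⁻¹` and reversing `V*`
leaves `a` alone, which gives the other three arrows.

`N` is a weighted difference of `K⁻¹` and `B⁻¹`, hence triangular on the flag of `V*`. It is also
one of the two new arrows, the `A` terms cancelling, hence triangular on the flag of `V+`.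
`triangular` turns each of these facts into eigenspaces.

Orderings come from a longest path of adjacent eigenvalues. The maps `K`, `B`, `K↓`, `B↓` come from
split decompositions: for the flags `f`, `g` of `A*` and `A`, the sum of `f_i ∩ g_j` over `i + j =
n` is invariant under both operators, so it is `0` or `V`. -/

namespace QOns

/-! ### Flags, decompositions and triangular operators -/

section Flags

variable {F : Type*} [Field F] {V : Type*} [AddCommGroup V] [Module F V] {d : ℕ}

/-- The partial sum `W_0 + ⋯ + W_{k-1}`. -/
def lowerSum (W : Fin (d + 1) → Submodule F V) (k : ℕ) : Submodule F V :=
  ⨆ (j : Fin (d + 1)) (_ : (j : ℕ) < k), W j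

lemma le_lowerSum (W : Fin (d + 1) → Submodule F V) {j : Fin (d + 1)} {k : ℕ} (h : (j : ℕ) < k) :
    W j ≤ lowerSum W k :=
  le_iSup₂_of_le j h le_rfl

lemma lowerSum_le {W : Fin (d + 1) → Submodule F V} {k : ℕ} {p : Submodule F V}
    (h : ∀ j : Fin (d + 1), (j : ℕ) < k → W j ≤ p) : lowerSum W k ≤ p :=
  iSup₂_le h

lemma lowerSum_mono (W : Fin (d + 1) → Submodule F V) : Monotone (lowerSum W) := fun _ _ hkl =>
  lowerSum_le fun _ hj => le_lowerSum W (hj.trans_le hkl)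

@[simp] lemma lowerSum_zero (W : Fin (d + 1) → Submodule F V) : lowerSum W 0 = ⊥ :=
  le_bot_iff.1 (lowerSum_le fun _ hj => absurd hj (Nat.not_lt_zero _))

lemma lowerSum_eq_iSup (W : Fin (d + 1) → Submodule F V) {k : ℕ} (hk : d + 1 ≤ k) :
    lowerSum W k = ⨆ j, W j :=
  le_antisymm (lowerSum_le fun j _ => le_iSup W j)
    (iSup_le fun j => le_lowerSum W (j.2.trans_le hk))

lemma lowerSum_succ (W : Fin (d + 1) → Submodule F V) (i : Fin (d + 1)) :
    lowerSum W (i + 1) = W i ⊔ lowerSum W i := by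
  refine le_antisymm (lowerSum_le fun j hj => ?_)
    (sup_le (le_lowerSum W (Nat.lt_succ_self _)) (lowerSum_mono W (Nat.le_succ _)))
  rcases Nat.lt_succ_iff_lt_or_eq.1 hj with h | h
  · exact le_sup_of_le_right (le_lowerSum W h)
  · rw [Fin.ext h]; exact le_sup_left

lemma sameFlag_iff {W W' : Fin (d + 1) → Submodule F V} :
    SameFlag W W' ↔ ∀ k, lowerSum W k = lowerSum W' k := by
  have key : ∀ (W : Fin (d + 1) → Submodule F V) (i : Fin (d + 1)),
      ⨆ (j : Fin (d + 1)) (_ : j ≤ i), W j = lowerSum W (i + 1) := fun W i => by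
    simp only [lowerSum, Nat.lt_succ_iff, Fin.le_def]
  constructor
  · intro h k
    have h' : ∀ k, k ≤ d + 1 → lowerSum W k = lowerSum W' k := by
      rintro (_ | k) hk
      · simp
      · have := h ⟨k, by omega⟩
        rwa [key, key] at this
    rcases le_total k (d + 1) with hk | hk
    · exact h' k hk
    · have := h' (d + 1) le_rfl
      rwa [lowerSum_eq_iSup _ le_rfl, lowerSum_eq_iSup _ le_rfl, ← lowerSum_eq_iSup W hk,
        ← lowerSum_eq_iSup W' hk] at this
  · intro h i
    rw [key, key, h]

@[simp] lemma inversion_inversion (W : Fin (d + 1) → Submodule F V) :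
    inversion (inversion W) = W := by
  funext i; simp [inversion]

lemma lowerSum_inversion_le {W : Fin (d + 1) → Submodule F V} {k : ℕ} {p : Submodule F V}
    (h : ∀ j : Fin (d + 1), d + 1 ≤ j + k → W j ≤ p) : lowerSum (inversion W) k ≤ p :=
  lowerSum_le fun j hj => h _ (by rw [Fin.val_rev]; omega)

lemma le_lowerSum_inversion (W : Fin (d + 1) → Submodule F V) {j : Fin (d + 1)} {k : ℕ}
    (h : d + 1 ≤ j + k) : W j ≤ lowerSum (inversion W) k := by
  have := le_lowerSum (inversion W) (j := j.rev) (k := k) (by rw [Fin.val_rev]; omega)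
  simpa [inversion] using this

lemma isDecomposition_iff {W : Fin (d + 1) → Submodule F V} :
    IsDecomposition W ↔ (∀ i, W i ≠ ⊥) ∧ iSupIndep W ∧ ⨆ i, W i = ⊤ := by
  rw [IsDecomposition, DirectSum.isInternal_submodule_iff_iSupIndep_and_iSup_eq_top]

lemma IsDecomposition.inversion {W : Fin (d + 1) → Submodule F V} (h : IsDecomposition W) :
    IsDecomposition (inversion W) := by
  rw [isDecomposition_iff] at h ⊢
  refine ⟨fun i => h.1 _, h.2.1.comp Fin.rev_injective, ?_⟩
  rw [← h.2.2]
  exact Fin.revPerm.iSup_comp (g := W)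

lemma IsDecomposition.lowerSum_eq_top {W : Fin (d + 1) → Submodule F V} (h : IsDecomposition W)
    {k : ℕ} (hk : d + 1 ≤ k) : lowerSum W k = ⊤ := by
  rw [lowerSum_eq_iSup W hk, (isDecomposition_iff.1 h).2.2]

lemma IsDecomposition.disjoint {W : Fin (d + 1) → Submodule F V} (h : IsDecomposition W)
    {k l : ℕ} (hkl : k + l ≤ d + 1) :
    lowerSum W k ⊓ lowerSum (QOns.inversion W) l = ⊥ := by
  have hW := (isDecomposition_iff.1 h).2.1
  have := iSupIndep.disjoint_biSup_biSup (α := Submodule F V) (f := W) hW (s := {j | (j : ℕ) < k}) (t := {j | d + 1 ≤ j + l})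
    (Set.disjoint_left.2 fun j h1 h2 => by simp only [Set.mem_ofPred_eq] at h1 h2; omega)
  rw [← le_bot_iff, ← this.eq_bot]
  exact inf_le_inf le_rfl (lowerSum_inversion_le fun j hj =>
    le_iSup₂_of_le (f := fun i (_ : i ∈ {j : Fin (d + 1) | d + 1 ≤ j + l}) => W i) j hj le_rfl)

/-- The modular law: the two opposite flags of a decomposition determine its summands. Uniqueness of
arrows rests on this. -/
lemma IsDecomposition.eq_inf {W : Fin (d + 1) → Submodule F V} (h : IsDecomposition W)
    (i : Fin (d + 1)) :
    W i = lowerSum W (i + 1) ⊓ lowerSum (QOns.inversion W) (d + 1 - i) := by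
  rw [lowerSum_succ, sup_inf_assoc_of_le _ (le_lowerSum_inversion W (by omega)),
    h.disjoint (by omega), sup_bot_eq]

lemma IsDecomposition.disjoint_lowerSum {W : Fin (d + 1) → Submodule F V} (h : IsDecomposition W)
    (i : Fin (d + 1)) {x : V} (hx : x ∈ W i) (hx' : x ∈ lowerSum W i) : x = 0 := by
  have := h.disjoint (k := i) (l := d + 1 - i) (by omega)
  rw [← Submodule.mem_bot F, ← this]
  exact ⟨hx', le_lowerSum_inversion W (by omega) hx⟩

lemma IsDecomposition.lowerSum_lt {W : Fin (d + 1) → Submodule F V} (h : IsDecomposition W)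
    {k : ℕ} (hk : k < d + 1) : lowerSum W k < lowerSum W (k + 1) := by
  refine lt_of_le_of_ne (lowerSum_mono W (Nat.le_succ k)) fun he => ?_
  obtain ⟨x, hx, hx0⟩ := Submodule.exists_mem_ne_zero_of_ne_bot (h.1 ⟨k, hk⟩)
  refine hx0 (h.disjoint_lowerSum _ hx ?_)
  simp only [he]
  exact le_lowerSum W (Nat.lt_succ_self k) hx

/-- An independent family of subspaces is determined by a spanning family contained in it. -/
lemma eq_of_le_of_iSup_eq_top {ι : Type*} {W M : ι → Submodule F V} (hM : iSupIndep M)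
    (hle : ∀ i, W i ≤ M i) (hW : ⨆ i, W i = ⊤) : W = M := by
  funext i
  refine le_antisymm (hle i) fun x hx => ?_
  have hx' : x ∈ W i ⊔ ⨆ (j) (_ : j ≠ i), W j := by
    rw [← iSup_split_single W i, hW]; trivial
  obtain ⟨y, hy, z, hz, rfl⟩ := Submodule.mem_sup.1 hx'
  have hz1 : z ∈ M i := by simpa using (M i).sub_mem hx (hle i hy)
  have hz2 : z ∈ ⨆ (j) (_ : j ≠ i), M j := iSup₂_mono (fun j _ => hle j) hz
  have : z = 0 := Submodule.disjoint_def.1 (hM i) z hz1 hz2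
  simpa [this] using hy

/-- A linear map may be prescribed on the summands of a decomposition. -/
lemma exists_linearMap_of_isInternal {W : Fin (d + 1) → Submodule F V}
    (hW : DirectSum.IsInternal W) (c : Fin (d + 1) → F) :
    ∃ g : Module.End F V, ∀ i, ∀ x ∈ W i, g x = c i • x := by
  let e := LinearEquiv.ofBijective (DirectSum.coeLinearMap W) hW
  refine ⟨(DirectSum.toModule F (Fin (d + 1)) V fun i => c i • (W i).subtype) ∘ₗ e.symm.toLinearMap,
    fun i x hx => ?_⟩
  have : e.symm x = DirectSum.lof F (Fin (d + 1)) (fun i => W i) i ⟨x, hx⟩ := by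
    rw [LinearEquiv.symm_apply_eq]
    exact (DirectSum.coeLinearMap_lof W i ⟨x, hx⟩).symm
  simp [this]

lemma ext_of_iSup_eq_top {ι : Type*} {W : ι → Submodule F V} (hW : ⨆ i, W i = ⊤)
    {f g : Module.End F V} (h : ∀ i, ∀ x ∈ W i, f x = g x) : f = g := by
  have : ⨆ i, W i ≤ LinearMap.eqLocus f g := iSup_le fun i x hx => h i x hx
  rw [hW, top_le_iff] at this
  exact LinearMap.eqLocus_eq_top.1 this

lemma iSupIndep_eigenspace (M : Module.End F V) {μ : Fin (d + 1) → F}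
    (hμ : Function.Injective μ) : iSupIndep fun i => M.eigenspace (μ i) :=
  M.eigenspaces_iSupIndep.comp hμ

/-- An operator that is triangular with respect to a decomposition, with distinct diagonal entries,
is diagonalizable, and its eigenspaces induce the same flag. -/
lemma triangular {W : Fin (d + 1) → Submodule F V} (hW : IsDecomposition W)
    {M : Module.End F V} {μ : Fin (d + 1) → F} (hμ : Function.Injective μ)
    (h : ∀ i : Fin (d + 1), ∀ x ∈ lowerSum W (i + 1), M x - μ i • x ∈ lowerSum W i) :
    IsDecomposition (fun i => M.eigenspace (μ i)) ∧
      ∀ k, lowerSum (fun i => M.eigenspace (μ i)) k = lowerSum W k := by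
  set E : Fin (d + 1) → Submodule F V := fun i => M.eigenspace (μ i) with hE
  have hind : iSupIndep E := iSupIndep_eigenspace M hμ
  have hup : ∀ k ≤ d + 1, lowerSum W k ≤ lowerSum E k := by
    intro k
    induction k with
    | zero => intro _; simp
    | succ k ih =>
      intro hk x hx
      let i : Fin (d + 1) := ⟨k, hk⟩
      have hy : M x - μ i • x ∈ lowerSum E k := ih (by omega) (h i x hx)
      -- `M - μ i` is onto on the sum of the earlier eigenspaces, because the `μ j` differ from `μ
      -- i`; this corrects `x` to an eigenvector.
      have hinv : ∀ y ∈ lowerSum E k, ∃ z ∈ lowerSum E k, M z - μ i • z = y := by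
        have : lowerSum E k ≤ (lowerSum E k).map (M - algebraMap F _ (μ i)) := by
          refine lowerSum_le fun j hj y hy => ?_
          have hne : μ j - μ i ≠ 0 := sub_ne_zero.2 fun he => by
            have := hμ he; rw [this] at hj; exact lt_irrefl _ hj
          refine ⟨(μ j - μ i)⁻¹ • y, (Submodule.smul_mem _ _ (le_lowerSum E hj hy)), ?_⟩
          have hMy : M y = μ j • y := Module.End.mem_eigenspace_iff.1 hy
          simp only [map_smul, LinearMap.sub_apply, Module.algebraMap_end_apply, hMy, ← sub_smul]
          rw [smul_smul, inv_mul_cancel₀ hne, one_smul]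
        intro y hy
        obtain ⟨z, hz, hzy⟩ := this hy
        exact ⟨z, hz, by simpa using hzy⟩
      obtain ⟨z, hz, hzy⟩ := hinv _ hy
      have hxz : x - z ∈ E i := by
        refine Module.End.mem_eigenspace_iff.2 ?_
        rw [map_sub, smul_sub]
        rw [sub_eq_sub_iff_sub_eq_sub]
        exact hzy.symm
      have := Submodule.add_mem _ (le_lowerSum E (k := k + 1) (Nat.lt_succ_self k) hxz)
        (lowerSum_mono E (Nat.le_succ k) hz)
      simpa using this
  have hdown : ∀ i, E i ≤ lowerSum W (i + 1) := by
    intro i x hx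
    -- Descend from the full space: `M - μ k` maps level `k + 1` to level `k` and acts on `x` as the
    -- nonzero scalar `μ i - μ k`.
    have : ∀ n k, k + n = d + 1 → (i : ℕ) < k → x ∈ lowerSum W k := by
      intro n
      induction n with
      | zero => intro k hk _; rw [hW.lowerSum_eq_top (by omega)]; trivial
      | succ n ih =>
        intro k hk hik
        have h1 := h ⟨k, by omega⟩ x (ih (k + 1) (by omega) (by omega))
        rw [Module.End.mem_eigenspace_iff.1 hx, ← sub_smul] at h1
        refine (Submodule.smul_mem_iff _ (sub_ne_zero.2 fun he => ?_)).1 h1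
        have := congrArg Fin.val (hμ he)
        simp only at this
        omega
    exact this (d - i) (i + 1) (by omega) (by omega)
  have heq : ∀ k, lowerSum E k = lowerSum W k := by
    intro k
    refine le_antisymm (lowerSum_le fun j hj => (hdown j).trans (lowerSum_mono W hj)) ?_
    rcases le_total k (d + 1) with hk | hk
    · exact hup k hk
    · rw [lowerSum_eq_iSup W hk, lowerSum_eq_iSup E hk, ← lowerSum_eq_iSup W le_rfl,
        ← lowerSum_eq_iSup E le_rfl]
      exact hup _ le_rfl
  refine ⟨isDecomposition_iff.2 ⟨fun i hi => ?_, hind, ?_⟩, heq⟩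
  · have h1 := hW.lowerSum_lt i.2
    rw [← heq, ← heq, lowerSum_succ] at h1
    change E i = ⊥ at hi
    rw [hi, bot_sup_eq] at h1
    exact lt_irrefl _ h1
  · rw [← lowerSum_eq_iSup E le_rfl, heq, hW.lowerSum_eq_top le_rfl]

lemma lowerSum_map (H : Module.End F V) (W : Fin (d + 1) → Submodule F V) (k : ℕ) :
    lowerSum (fun i => (W i).map H) k = (lowerSum W k).map H := by
  simp only [lowerSum, Submodule.map_iSup]

end Flags

/-! ### Split decompositions from a pair of flags -/

section Split

variable {F : Type*} [Field F] {V : Type*} [AddCommGroup V] [Module F V] {d δ : ℕ}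

lemma apply_sub_smul_mem_lowerSum {W : Fin (d + 1) → Submodule F V} {f : Module.End F V}
    {c : Fin (d + 1) → F} (h : ∀ j, ∀ x ∈ W j, f x = c j • x) (i : Fin (d + 1))
    {x : V} (hx : x ∈ lowerSum W (i + 1)) : f x - c i • x ∈ lowerSum W i := by
  suffices h' : lowerSum W (i + 1) ≤ (lowerSum W i).comap (f - algebraMap F _ (c i)) by
    simpa using h' hx
  refine lowerSum_le fun j hj y hy => ?_
  simp only [Submodule.mem_comap, LinearMap.sub_apply, Module.algebraMap_end_apply, h j y hy,
    ← sub_smul]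
  rcases Nat.lt_succ_iff_lt_or_eq.1 hj with h | h
  · exact Submodule.smul_mem _ _ (le_lowerSum _ h hy)
  · rw [Fin.ext h, sub_self, zero_smul]; exact zero_mem _

lemma mem_lowerSum_eigenspaces_sub {f : Module.End F V} {θ : Fin (d + 1) → F} (i : Fin (d + 1))
    {x : V} (hx : x ∈ lowerSum (eigenspaces f θ) (i + 1)) :
    f x - θ i • x ∈ lowerSum (eigenspaces f θ) i :=
  apply_sub_smul_mem_lowerSum (fun _ _ hy => Module.End.mem_eigenspace_iff.1 hy) i hx

lemma ThreeTerm.apply_mem_lowerSum {g : Module.End F V} {W : Fin (d + 1) → Submodule F V}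
    (h : ThreeTerm g W) {k : ℕ} {x : V} (hx : x ∈ lowerSum W k) : g x ∈ lowerSum W (k + 1) := by
  suffices h' : lowerSum W k ≤ (lowerSum W (k + 1)).comap g from h' hx
  refine lowerSum_le fun j hj => Submodule.map_le_iff_le_comap.1 ((h j).trans ?_)
  exact iSup₂_le fun i hi => le_lowerSum W (by omega)

lemma ThreeTerm.inversion {g : Module.End F V} {W : Fin (d + 1) → Submodule F V}
    (h : ThreeTerm g W) : ThreeTerm g (inversion W) := by
  intro i
  refine (h i.rev).trans (iSup₂_le fun j hj => ?_)
  have : W j = QOns.inversion W j.rev := by simp [QOns.inversion]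
  rw [this]
  refine le_iSup₂_of_le j.rev ?_ le_rfl
  rw [Fin.val_rev] at hj ⊢
  omega

lemma isDecomposition_eigenspaces {f : Module.End F V} (hf : Diagonalizable f)
    {θ : Fin (d + 1) → F} (hθ : IsEigenvalueOrdering f θ) :
    IsDecomposition (eigenspaces f θ) := by
  refine isDecomposition_iff.2 ⟨fun i => (hθ.2 _).2 ⟨i, rfl⟩, iSupIndep_eigenspace f hθ.1, ?_⟩
  rw [eq_top_iff, ← hf]
  refine iSup_le fun μ => ?_
  by_cases hμ : f.HasEigenvalue μ
  · obtain ⟨i, rfl⟩ := (hθ.2 μ).1 hμ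
    exact le_iSup (eigenspaces f θ) i
  · rw [Module.End.hasEigenvalue_iff, not_not] at hμ
    rw [hμ]; exact bot_le

/-- Two flags, on each of which one of `A`, `A*` is triangular and the other one raises by at most
one step. -/
structure FlagPair (A As : Module.End F V) (f g : ℕ → Submodule F V) : Prop where
  mono_left : Monotone f
  mono_right : Monotone g
  left_zero : f 0 = ⊥
  right_zero : g 0 = ⊥
  raise_left : ∀ k, ∀ x ∈ f k, A x ∈ f (k + 1)
  raise_right : ∀ k, ∀ x ∈ g k, As x ∈ g (k + 1)
  lower_left : ∀ k, ∃ c : F, ∀ x ∈ f (k + 1), As x - c • x ∈ f k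
  lower_right : ∀ k, ∃ c : F, ∀ x ∈ g (k + 1), A x - c • x ∈ g k

/-- The pair `A`, `A*` acts irreducibly on `V`. -/
def IrreduciblePair (A As : Module.End F V) : Prop :=
  ∀ p : Submodule F V, (∀ x ∈ p, A x ∈ p) → (∀ x ∈ p, As x ∈ p) → p = ⊥ ∨ p = ⊤

lemma IrreduciblePair.symm {A As : Module.End F V} (h : IrreduciblePair A As) :
    IrreduciblePair As A := fun p h1 h2 => h p h2 h1

lemma exists_lower_eigenspaces (f : Module.End F V) (θ : Fin (d + 1) → F) (k : ℕ) :
    ∃ c : F, ∀ x ∈ lowerSum (eigenspaces f θ) (k + 1),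
      f x - c • x ∈ lowerSum (eigenspaces f θ) k := by
  by_cases hk : k < d + 1
  · exact ⟨θ ⟨k, hk⟩, fun x hx => mem_lowerSum_eigenspaces_sub ⟨k, hk⟩ hx⟩
  -- Beyond index `d` the flag is constant and `f`-invariant, so the scalar is irrelevant.
  · refine ⟨0, fun x hx => ?_⟩
    have hle : lowerSum (eigenspaces f θ) (k + 1) ≤ lowerSum (eigenspaces f θ) k :=
      lowerSum_le fun j _ => le_lowerSum _ (by omega)
    have hinv : lowerSum (eigenspaces f θ) k ≤ (lowerSum (eigenspaces f θ) k).comap f := by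
      refine lowerSum_le fun j hj y hy => ?_
      have hy' : f y = θ j • y := Module.End.mem_eigenspace_iff.1 hy
      rw [Submodule.mem_comap, hy']
      exact Submodule.smul_mem _ _ (le_lowerSum _ hj hy)
    rw [zero_smul, sub_zero]
    exact hinv (hle hx)

lemma flagPair_of_threeTerm {A As : Module.End F V} {θ : Fin (d + 1) → F} {θs : Fin (δ + 1) → F}
    (h : ThreeTerm A (eigenspaces As θs)) (hs : ThreeTerm As (eigenspaces A θ)) :
    FlagPair A As (lowerSum (eigenspaces As θs)) (lowerSum (eigenspaces A θ)) where
  mono_left := lowerSum_mono _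
  mono_right := lowerSum_mono _
  left_zero := lowerSum_zero _
  right_zero := lowerSum_zero _
  raise_left _ _ hx := h.apply_mem_lowerSum hx
  raise_right _ _ hx := hs.apply_mem_lowerSum hx
  lower_left := exists_lower_eigenspaces As θs
  lower_right := exists_lower_eigenspaces A θ

lemma FlagPair.symm {A As : Module.End F V} {f g : ℕ → Submodule F V} (h : FlagPair A As f g) :
    FlagPair As A g f where
  mono_left := h.mono_right
  mono_right := h.mono_left
  left_zero := h.right_zero
  right_zero := h.left_zero
  raise_left := h.raise_right
  raise_right := h.raise_left
  lower_left := h.lower_right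
  lower_right := h.lower_left

/-- The sum of the intersections `f i ∩ g j` with `i + j = n`. -/
def antidiagonalSum (f g : ℕ → Submodule F V) (n : ℕ) : Submodule F V :=
  ⨆ (i : ℕ) (j : ℕ) (_ : i + j = n), f i ⊓ g j

lemma le_antidiagonalSum (f g : ℕ → Submodule F V) (i j : ℕ) :
    f i ⊓ g j ≤ antidiagonalSum f g (i + j) :=
  le_iSup_of_le i (le_iSup₂_of_le j rfl le_rfl)

lemma antidiagonalSum_comm (f g : ℕ → Submodule F V) (n : ℕ) :
    antidiagonalSum f g n = antidiagonalSum g f n := by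
  have : ∀ f g : ℕ → Submodule F V, antidiagonalSum f g n ≤ antidiagonalSum g f n := fun f g =>
    iSup_le fun i => iSup₂_le fun j hij => by
      rw [inf_comm, ← hij, add_comm]; exact le_antidiagonalSum g f j i
  exact le_antisymm (this f g) (this g f)

/-- `A - c` raises the first flag by one and lowers the second by one, so it stays on the
antidiagonal. By symmetry so does `A*`. -/
lemma FlagPair.apply_mem_antidiagonalSum {A As : Module.End F V} {f g : ℕ → Submodule F V}
    (h : FlagPair A As f g) (n : ℕ) (x : V) (hx : x ∈ antidiagonalSum f g n) :
    A x ∈ antidiagonalSum f g n := by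
  suffices h' : antidiagonalSum f g n ≤ (antidiagonalSum f g n).comap A from h' hx
  refine iSup_le fun i => iSup₂_le ?_
  rintro (_ | j) rfl y ⟨hyf, hyg⟩
  · have hy : y ∈ g 0 := hyg
    rw [h.right_zero, Submodule.mem_bot] at hy
    subst hy; exact zero_mem _
  · obtain ⟨c, hc⟩ := h.lower_right j
    have h1 : A y - c • y ∈ antidiagonalSum f g (i + (j + 1)) := by
      have := le_antidiagonalSum f g (i + 1) j
      rw [add_right_comm] at this
      exact this ⟨sub_mem (h.raise_left _ _ hyf)
        (Submodule.smul_mem _ _ (h.mono_left (Nat.le_succ i) hyf)), hc y hyg⟩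
    have h2 := Submodule.smul_mem _ c (le_antidiagonalSum f g i (j + 1) ⟨hyf, hyg⟩)
    simpa using add_mem h1 h2

lemma FlagPair.antidiagonalSum_eq {A As : Module.End F V} {f g : ℕ → Submodule F V}
    (h : FlagPair A As f g) (hirr : IrreduciblePair A As) (n : ℕ) :
    antidiagonalSum f g n = ⊥ ∨ antidiagonalSum f g n = ⊤ := by
  refine hirr _ (h.apply_mem_antidiagonalSum n) ?_
  rw [antidiagonalSum_comm]
  exact h.symm.apply_mem_antidiagonalSum n

/-- Terms with `i = 0` vanish and all others have `j ≤ n`, so the sum lies in the proper subspace `g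
n`. -/
lemma FlagPair.antidiagonalSum_eq_bot {A As : Module.End F V} {f g : ℕ → Submodule F V}
    (h : FlagPair A As f g) (hirr : IrreduciblePair A As) {n : ℕ} (hg : g n ≠ ⊤) :
    antidiagonalSum f g (n + 1) = ⊥ := by
  refine (h.antidiagonalSum_eq hirr _).resolve_right fun htop => hg ?_
  rw [eq_top_iff, ← htop]
  refine iSup_le ?_
  rintro (_ | i)
  · exact iSup₂_le fun j _ => by rw [h.left_zero, bot_inf_eq]; exact bot_le
  · exact iSup₂_le fun j hj => inf_le_right.trans (h.mono_right (by omega))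

/-- If `d < δ`, then `g (δ - d) = f (d + 1) ∩ g (δ - d)` lies on the antidiagonal `δ + 1`, whose sum
is zero. -/
lemma FlagPair.length_le {A As : Module.End F V} {f g : ℕ → Submodule F V}
    (h : FlagPair A As f g) (hirr : IrreduciblePair A As) (hf : f (d + 1) = ⊤)
    (hg : g δ ≠ ⊤) (hg1 : g 1 ≠ ⊥) : δ ≤ d := by
  by_contra! hlt
  have h1 := h.antidiagonalSum_eq_bot hirr hg
  have h2 := le_antidiagonalSum f g (d + 1) (δ - d)
  rw [show d + 1 + (δ - d) = δ + 1 by omega, h1, hf, top_inf_eq, le_bot_iff] at h2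
  exact hg1 (le_bot_iff.1 (h2 ▸ h.mono_right (by omega)))

/-- Antidiagonal `d + 1` sums to `0` and antidiagonal `d + 2` sums to `V`. The terms of the latter
are the summands; vanishing of the former makes them independent and forces their partial sums to
fill the two flags. -/
lemma FlagPair.exists_split {A As : Module.End F V} {X Y : Fin (d + 1) → Submodule F V}
    (h : FlagPair A As (lowerSum X) (lowerSum Y)) (hirr : IrreduciblePair A As)
    (hX : IsDecomposition X) (hY : IsDecomposition Y) :
    ∃ W : Fin (d + 1) → Submodule F V,
      IsDecomposition W ∧ SameFlag W X ∧ SameFlag (inversion W) Y := by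
  set f := lowerSum X
  set g := lowerSum Y
  have hfg : ∀ k l, k + l = d + 1 → f k ⊓ g l = ⊥ := fun k l hkl => by
    have h1 := h.antidiagonalSum_eq_bot hirr (n := d)
      ((hY.lowerSum_lt (Nat.lt_succ_self d)).ne_top)
    exact le_bot_iff.1 (h1 ▸ hkl ▸ le_antidiagonalSum f g k l)
  have hftop : f (d + 1) = ⊤ := hX.lowerSum_eq_top le_rfl
  have hgtop : g (d + 1) = ⊤ := hY.lowerSum_eq_top le_rfl
  set W : Fin (d + 1) → Submodule F V := fun i => f (i + 1) ⊓ g (d + 1 - i) with hW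
  have hWtop : ⨆ i, W i = ⊤ := by
    have h2 : antidiagonalSum f g (d + 2) = ⊤ := by
      refine (h.antidiagonalSum_eq hirr _).resolve_left fun hbot => ?_
      have h3 := le_antidiagonalSum f g (d + 1) 1
      rw [hbot, hftop, top_inf_eq, le_bot_iff] at h3
      have h4 := hY.lowerSum_lt (Nat.succ_pos d)
      exact h4.ne_bot h3
    rw [eq_top_iff, ← h2]
    refine iSup_le fun i => iSup₂_le fun j hij => ?_
    rcases i with _ | i
    · rw [h.left_zero, bot_inf_eq]; exact bot_le
    · rcases j with _ | j
      · rw [h.right_zero, inf_bot_eq]; exact bot_le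
      · refine le_iSup_of_le ⟨i, by omega⟩ (inf_le_inf le_rfl (h.mono_right ?_))
        simp only; omega
  have hlow : ∀ k ≤ d + 1, lowerSum W k ≤ f k := fun k _ =>
    lowerSum_le fun j hj => inf_le_left.trans (h.mono_left hj)
  have hup : ∀ k, lowerSum (inversion W) k ≤ g k := fun k =>
    lowerSum_inversion_le fun j hj => inf_le_right.trans (h.mono_right (by omega))
  have hsplit : ∀ k ≤ d + 1, lowerSum W k ⊔ lowerSum (inversion W) (d + 1 - k) = ⊤ := by
    intro k hk
    rw [eq_top_iff, ← hWtop]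
    refine iSup_le fun j => ?_
    rcases lt_or_ge (j : ℕ) k with hj | hj
    · exact le_sup_of_le_left (le_lowerSum W hj)
    · exact le_sup_of_le_right (le_lowerSum_inversion W (by omega))
  have hlow' : ∀ k ≤ d + 1, lowerSum W k = f k := by
    intro k hk
    refine le_antisymm (hlow k hk) fun x hx => ?_
    obtain ⟨y, hy, z, hz, rfl⟩ := Submodule.mem_sup.1 (hsplit k hk ▸ Submodule.mem_top (x := x))
    have hz0 : z ∈ f k ⊓ g (d + 1 - k) :=
      ⟨by simpa using sub_mem hx (hlow k hk hy), hup _ hz⟩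
    rw [hfg _ _ (by omega), Submodule.mem_bot] at hz0
    simpa [hz0] using hy
  have hup' : ∀ k ≤ d + 1, lowerSum (inversion W) k = g k := by
    intro k hk
    refine le_antisymm (hup k) fun x hx => ?_
    obtain ⟨y, hy, z, hz, rfl⟩ :=
      Submodule.mem_sup.1 (hsplit (d + 1 - k) (by omega) ▸ Submodule.mem_top (x := x))
    rw [show d + 1 - (d + 1 - k) = k by omega] at hz
    have hy0 : y ∈ f (d + 1 - k) ⊓ g k :=
      ⟨hlow _ (by omega) hy, by simpa using sub_mem hx (hup _ hz)⟩
    rw [hfg _ _ (by omega), Submodule.mem_bot] at hy0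
    simpa [hy0] using hz
  have hflag : ∀ {Z : Fin (d + 1) → Submodule F V} {Z' : Fin (d + 1) → Submodule F V},
      (∀ k ≤ d + 1, lowerSum Z k = lowerSum Z' k) → SameFlag Z Z' := by
    intro Z Z' hZ
    refine sameFlag_iff.2 fun k => ?_
    rcases le_total k (d + 1) with hk | hk
    · exact hZ k hk
    · rw [lowerSum_eq_iSup Z hk, lowerSum_eq_iSup Z' hk, ← lowerSum_eq_iSup Z le_rfl,
        ← lowerSum_eq_iSup Z' le_rfl, hZ _ le_rfl]
  refine ⟨W, isDecomposition_iff.2 ⟨fun i hi => ?_, fun i => ?_, hWtop⟩, hflag hlow', hflag hup'⟩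
  · have h1 := hX.lowerSum_lt i.2
    change f i < f (i + 1) at h1
    rw [← hlow' i (by omega), ← hlow' (i + 1) (by omega), lowerSum_succ, hi, bot_sup_eq] at h1
    exact lt_irrefl _ h1
  · refine Submodule.disjoint_def.2 fun x hx hx' => ?_
    have hle : (⨆ (j) (_ : j ≠ i), W j) ≤ lowerSum W i ⊔ lowerSum (inversion W) (d - i) := by
      refine iSup₂_le fun j hj => ?_
      rcases lt_or_gt_of_ne (fun h => hj (Fin.ext h) : (j : ℕ) ≠ i) with h1 | h1
      · exact le_sup_of_le_left (le_lowerSum W h1)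
      · exact le_sup_of_le_right (le_lowerSum_inversion W (by omega))
    obtain ⟨y, hy, z, hz, rfl⟩ := Submodule.mem_sup.1 (hle hx')
    have hy1 := hlow i (by omega) hy
    have hz1 := hup _ hz
    have hz0 : z ∈ f (i + 1) ⊓ g (d - i) :=
      ⟨by simpa using sub_mem hx.1 (h.mono_left (Nat.le_succ _) hy1), hz1⟩
    rw [hfg _ _ (by omega), Submodule.mem_bot] at hz0
    have hy0 : y ∈ f i ⊓ g (d + 1 - i) := ⟨hy1, by simpa [hz0] using hx.2⟩
    rw [hfg _ _ (by omega), Submodule.mem_bot] at hy0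
    rw [hy0, hz0, add_zero]

/-! ### Existence and uniqueness of arrows -/

section Arrow

lemma zpow_injective_of_pow_ne_one {q : F} (hq : q ≠ 0) (hq_root : ∀ n : ℕ, 0 < n → q ^ n ≠ 1)
    {m n : ℤ} (h : q ^ m = q ^ n) : m = n := by
  by_contra hne
  have key : ∀ m n : ℤ, m < n → q ^ m = q ^ n → False := fun m n hlt h => by
    have h1 : q ^ (n - m) = 1 := by
      rw [zpow_sub₀ hq, h, div_self (zpow_ne_zero _ hq)]
    obtain ⟨k, hk⟩ := Int.eq_ofNat_of_zero_le (sub_nonneg.2 hlt.le)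
    rw [hk, zpow_natCast] at h1
    exact hq_root k (by omega) h1
  rcases lt_or_gt_of_ne hne with h1 | h1
  · exact key _ _ h1 h
  · exact key _ _ h1 h.symm

lemma weight_injective {q : F} (hq : q ≠ 0) (hq_root : ∀ n : ℕ, 0 < n → q ^ n ≠ 1) (d : ℕ) :
    Function.Injective fun i : Fin (d + 1) => q ^ ((d : ℤ) - 2 * ((i : ℕ) : ℤ)) := by
  intro i j h
  have := zpow_injective_of_pow_ne_one hq hq_root h
  exact Fin.ext (by omega)

lemma IsArrow.weightSpaces_eq {q : F} {M : Module.End F V} {X Y : Fin (d + 1) → Submodule F V}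
    (h : IsArrow q M X Y) (i : Fin (d + 1)) :
    weightSpaces q d M i = lowerSum X (i + 1) ⊓ lowerSum Y (d + 1 - i) := by
  rw [h.decomposition.eq_inf, sameFlag_iff.1 h.source, sameFlag_iff.1 h.target]

lemma IsArrow.unique {q : F} {M M' : Module.End F V} {X Y : Fin (d + 1) → Submodule F V}
    (h : IsArrow q M X Y) (h' : IsArrow q M' X Y) : M = M' := by
  refine ext_of_iSup_eq_top (isDecomposition_iff.1 h.decomposition).2.2 fun i x hx => ?_
  have hx' : x ∈ weightSpaces q d M' i := by rwa [h'.weightSpaces_eq, ← h.weightSpaces_eq]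
  rw [Module.End.mem_eigenspace_iff.1 hx, Module.End.mem_eigenspace_iff.1 hx']

lemma exists_isArrow {q : F} (hq : q ≠ 0) (hq_root : ∀ n : ℕ, 0 < n → q ^ n ≠ 1)
    {W X Y : Fin (d + 1) → Submodule F V} (hW : IsDecomposition W) (hX : SameFlag W X)
    (hY : SameFlag (inversion W) Y) : ∃ M : (Module.End F V)ˣ, IsArrow q (M : Module.End F V) X Y := by
  obtain ⟨M, hM⟩ := exists_linearMap_of_isInternal hW.2 fun i => q ^ ((d : ℤ) - 2 * ((i : ℕ) : ℤ))
  obtain ⟨N, hN⟩ :=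
    exists_linearMap_of_isInternal hW.2 fun i => (q ^ ((d : ℤ) - 2 * ((i : ℕ) : ℤ)))⁻¹
  have hne : ∀ i : Fin (d + 1), q ^ ((d : ℤ) - 2 * ((i : ℕ) : ℤ)) ≠ 0 :=
    fun i => zpow_ne_zero _ hq
  have htop := (isDecomposition_iff.1 hW).2.2
  have hMN : M * N = 1 := ext_of_iSup_eq_top htop fun i x hx => by
    rw [Module.End.mul_apply, hN i x hx, map_smul, hM i x hx, smul_smul, inv_mul_cancel₀ (hne i),
      one_smul, Module.End.one_apply]
  have hNM : N * M = 1 := ext_of_iSup_eq_top htop fun i x hx => by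
    rw [Module.End.mul_apply, hM i x hx, map_smul, hN i x hx, smul_smul, mul_inv_cancel₀ (hne i),
      one_smul, Module.End.one_apply]
  have hWM : W = weightSpaces q d M :=
    eq_of_le_of_iSup_eq_top (iSupIndep_eigenspace M (weight_injective hq hq_root d))
      (fun i x hx => Module.End.mem_eigenspace_iff.2 (hM i x hx)) htop
  exact ⟨⟨M, N, hMN, hNM⟩, ⟨hWM ▸ hW, hWM ▸ hX, hWM ▸ hY⟩⟩

lemma existsUnique_isArrow {q : F} (hq : q ≠ 0) (hq_root : ∀ n : ℕ, 0 < n → q ^ n ≠ 1)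
    {A As : Module.End F V} {X Y : Fin (d + 1) → Submodule F V}
    (h : FlagPair A As (lowerSum X) (lowerSum Y)) (hirr : IrreduciblePair A As)
    (hX : IsDecomposition X) (hY : IsDecomposition Y) :
    ∃! M : (Module.End F V)ˣ, IsArrow q (M : Module.End F V) X Y := by
  obtain ⟨W, hW, hWX, hWY⟩ := h.exists_split hirr hX hY
  obtain ⟨M, hM⟩ := exists_isArrow hq hq_root hW hWX hWY
  exact ⟨M, hM, fun M' hM' => Units.ext (hM'.unique hM)⟩

end Arrow

end Split

/-! ### Ordering the eigenvalues -/

section Ordering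

variable {F : Type*} [Field F] {V : Type*} [AddCommGroup V] [Module F V] {d : ℕ}

/-- The first `q`-Dolan/Grady relation for a pair of operators. -/
def DolanGradyRel (q : F) (A As : Module.End F V) : Prop :=
  bracket A (qBracket q⁻¹ A (qBracket q A As)) = (q ^ 2 - q⁻¹ ^ 2) ^ 2 • bracket As A

/-- The kernel of `p(f)` is `f`-invariant, so it splits along the eigenspaces, and it meets the one
for `ν` trivially unless `p(ν) = 0`. -/
lemma mem_iSup_of_aeval_eq_zero [FiniteDimensional F V] {f : Module.End F V}
    (hf : Diagonalizable f) (p : Polynomial F) {y : V} (hy : Polynomial.aeval f p y = 0) :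
    y ∈ ⨆ (ν : F) (_ : p.eval ν = 0), f.eigenspace ν := by
  have hinv : ∀ x ∈ LinearMap.ker (Polynomial.aeval f p),
      f x ∈ LinearMap.ker (Polynomial.aeval f p) := fun x hx => by
    have hcomm : Commute f (Polynomial.aeval f p) := by
      simpa using (Commute.all Polynomial.X p).map (Polynomial.aeval f)
    have := LinearMap.congr_fun hcomm.eq x
    rw [Module.End.mul_apply, Module.End.mul_apply, LinearMap.mem_ker.1 hx, map_zero] at this
    exact LinearMap.mem_ker.2 this.symm
  have h := Submodule.inf_iSup_genEigenspace hinv 1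
  have hf' : ⨆ μ, f.genEigenspace μ 1 = ⊤ := hf
  rw [hf', inf_top_eq] at h
  have hy' : y ∈ LinearMap.ker (Polynomial.aeval f p) := hy
  rw [h] at hy'
  refine (iSup_le fun ν => ?_ : _ ≤ ⨆ (ν : F) (_ : p.eval ν = 0), f.eigenspace ν) hy'
  by_cases hν : p.eval ν = 0
  · exact le_iSup₂_of_le ν hν inf_le_right
  · rintro x ⟨hx1, hx2⟩
    suffices x = 0 by rw [this]; exact zero_mem _
    by_contra hx0
    have h1 := Module.End.aeval_apply_of_hasEigenvector (p := p)
      (⟨hx2, hx0⟩ : f.HasEigenvector ν x)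
    rw [LinearMap.mem_ker.1 hx1] at h1
    exact (smul_ne_zero hν hx0) h1.symm

lemma Adjacent.symm {q x y : F} (h : Adjacent q x y) : Adjacent q y x :=
  ⟨h.1.symm, by linear_combination h.2⟩

/-- On an eigenvector for `μ` the relation becomes a cubic in `A` annihilating `A* x`. The cubic is
`(t - μ) P(μ, t)`, with `P` the adjacency polynomial. -/
lemma DolanGradyRel.apply_mem [FiniteDimensional F V] {q : F} (hq : q ≠ 0) {A As : Module.End F V}
    (h : DolanGradyRel q A As) (hA : Diagonalizable A) {μ : F} {x : V}
    (hx : x ∈ A.eigenspace μ) :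
    As x ∈ ⨆ (ν : F) (_ : ν = μ ∨ Adjacent q μ ν), A.eigenspace ν := by
  have hx' : A x = μ • x := Module.End.mem_eigenspace_iff.1 hx
  let p : Polynomial F := (Polynomial.X - Polynomial.C μ) *
    (Polynomial.X ^ 2 - Polynomial.C ((q ^ 2 + q⁻¹ ^ 2) * μ) * Polynomial.X +
      Polynomial.C (μ ^ 2 + (q ^ 2 - q⁻¹ ^ 2) ^ 2))
  have hp : Polynomial.aeval A p (As x) = 0 := by
    have h1 := LinearMap.congr_fun h x
    simp only [bracket, qBracket, LinearMap.sub_apply, LinearMap.smul_apply, Module.End.mul_apply,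
      map_sub, map_smul, hx', smul_sub, smul_smul, inv_inv] at h1
    simp only [p, map_mul, map_sub, map_add, Polynomial.aeval_X, Polynomial.aeval_C,
      Module.End.mul_apply, LinearMap.sub_apply, LinearMap.add_apply, pow_two,
      Module.algebraMap_end_apply, map_smul]
    rw [← sub_eq_zero] at h1
    rw [← h1]
    match_scalars <;> field_simp <;> ring
  refine SetLike.le_def.1 (iSup₂_le fun ν hν => ?_) (mem_iSup_of_aeval_eq_zero hA p hp)
  refine le_iSup₂_of_le ν ?_ le_rfl
  by_cases hνμ : ν = μ
  · exact Or.inl hνμ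
  · refine Or.inr ⟨Ne.symm hνμ, ?_⟩
    simp only [p, Polynomial.eval_mul, Polynomial.eval_sub, Polynomial.eval_add,
      Polynomial.eval_pow, Polynomial.eval_X, Polynomial.eval_C] at hν
    have := (mul_eq_zero.1 hν).resolve_left (sub_ne_zero.2 hνμ)
    linear_combination this

lemma Diagonalizable.exists_hasEigenvalue [Nontrivial V] {f : Module.End F V}
    (hf : Diagonalizable f) : ∃ μ, f.HasEigenvalue μ := by
  by_contra! h
  have : ⨆ μ : F, f.eigenspace μ = ⊥ := iSup_eq_bot.2 fun μ => by
    have := h μ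
    rwa [Module.End.hasEigenvalue_iff, not_not] at this
  exact bot_ne_top (this.symm.trans hf)

/-- A longest path of pairwise distinct eigenvalues is closed under adjacency. -/
lemma exists_adjacent_closed_chain [FiniteDimensional F V] [Nontrivial V] (q : F)
    {A : Module.End F V} (hA : Diagonalizable A) :
    ∃ l : List F, l ≠ [] ∧ l.Nodup ∧ l.IsChain (Adjacent q) ∧ (∀ x ∈ l, A.HasEigenvalue x) ∧
      ∀ x ∈ l, ∀ y, A.HasEigenvalue y → Adjacent q x y → y ∈ l := by
  classical
  let P : List F → Prop := fun l =>
    l.Nodup ∧ l.IsChain (Adjacent q) ∧ ∀ x ∈ l, A.HasEigenvalue x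
  have hfin := A.finite_hasEigenvalue
  set N := hfin.toFinset.card
  have hbound : ∀ l, P l → l.length ≤ N := fun l hl => by
    rw [← List.toFinset_card_of_nodup hl.1]
    exact Finset.card_le_card fun x hx => hfin.mem_toFinset.2 (hl.2.2 x (List.mem_toFinset.1 hx))
  obtain ⟨μ, hμ⟩ := hA.exists_hasEigenvalue
  have h1 : P [μ] := ⟨List.nodup_singleton _, List.isChain_singleton _, by simpa using hμ⟩
  let Q : ℕ → Prop := fun n => ∃ l, P l ∧ l.length = n
  have hQ1 : Q 1 := ⟨_, h1, rfl⟩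
  obtain ⟨l, hl, hlen⟩ : Q (Nat.findGreatest Q N) := Nat.findGreatest_spec (hbound _ h1) hQ1
  have hmax : ∀ l', P l' → l'.length ≤ l.length := fun l' hl' => by
    rw [hlen]; exact Nat.le_findGreatest (hbound _ hl') ⟨l', hl', rfl⟩
  refine ⟨l, ?_, hl.1, hl.2.1, hl.2.2, ?_⟩
  · rintro rfl
    exact absurd (hmax _ h1) (by simp)
  intro x hx y hy hxy
  by_contra hyl
  obtain ⟨s, t, rfl⟩ := List.append_of_mem hx
  obtain ⟨hnd, hch, hev⟩ := hl
  -- At either end of the path `y` could be appended, against maximality; an interior `x` already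
  -- has two neighbours `u`, `v`.
  rcases s.eq_nil_or_concat with rfl | ⟨s, u, rfl⟩
  · refine absurd (hmax (y :: x :: t) ⟨List.nodup_cons.2 ⟨hyl, hnd⟩,
      List.isChain_cons_cons.2 ⟨hxy.symm, hch⟩, ?_⟩) (by simp)
    intro z hz
    rcases List.mem_cons.1 hz with rfl | hz
    · exact hy
    · exact hev z hz
  · rcases t with _ | ⟨v, t⟩
    · refine absurd (hmax ((s.concat u ++ [x]) ++ [y]) ⟨?_, ?_, ?_⟩) (by simp)
      · exact List.Nodup.append hnd (List.nodup_singleton _) (by simpa using hyl)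
      · rw [List.isChain_append]
        exact ⟨hch, List.isChain_singleton _, by simpa using hxy⟩
      · intro z hz
        rcases List.mem_append.1 hz with hz | hz
        · exact hev z hz
        · rw [List.mem_singleton.1 hz]; exact hy
    · have hux : Adjacent q u x := by
        rw [List.concat_eq_append, List.append_assoc, List.isChain_append] at hch
        exact (List.isChain_cons_cons.1 hch.2.1).1
      have hxv : Adjacent q x v := by
        rw [List.isChain_append] at hch
        exact (List.isChain_cons_cons.1 hch.2.1).1
      have huv : u ≠ v := by
        rintro rfl
        rw [List.nodup_append] at hnd
        exact hnd.2.2 u (by simp) u (by simp) rfl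
      have hyu : y ≠ u := by rintro rfl; exact hyl (by simp)
      have hyv : y ≠ v := by rintro rfl; exact hyl (by simp)
      -- `P(x, ·)` is quadratic and cannot have the three distinct roots `y`, `u`, `v`.
      have e1 : (y - u) * (y + u - (q ^ 2 + q⁻¹ ^ 2) * x) = 0 := by
        linear_combination hxy.2 - hux.2
      have e2 : (y - v) * (y + v - (q ^ 2 + q⁻¹ ^ 2) * x) = 0 := by
        linear_combination hxy.2 - hxv.2
      have e1' := (mul_eq_zero.1 e1).resolve_left (sub_ne_zero.2 hyu)
      have e2' := (mul_eq_zero.1 e2).resolve_left (sub_ne_zero.2 hyv)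
      exact huv (by linear_combination e1' - e2')

/-- The eigenspaces along a closed path span a subspace invariant under both operators, hence `V`,
so the path contains every eigenvalue. -/
theorem exists_eigenvalueOrdering [FiniteDimensional F V] {q : F} (hq : q ≠ 0)
    {A As : Module.End F V} (h : DolanGradyRel q A As) (hirr : IrreduciblePair A As)
    (hA : Diagonalizable A) (hAs : Diagonalizable As) (hV : 2 ≤ Module.finrank F V) :
    ∃ d : ℕ, 1 ≤ d ∧ ∃ θ : Fin (d + 1) → F, IsEigenvalueOrdering A θ ∧
      ∀ i : Fin d, Adjacent q (θ i.castSucc) (θ i.succ) := by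
  have : Nontrivial V := Module.nontrivial_of_finrank_pos (R := F) (by omega)
  obtain ⟨l, hne, hnd, hch, hev, hcl⟩ := exists_adjacent_closed_chain q hA
  have htop : ⨆ (ν : F) (_ : ν ∈ l), A.eigenspace ν = ⊤ := by
    refine (hirr (⨆ (ν : F) (_ : ν ∈ l), A.eigenspace ν) ?_ ?_).resolve_left ?_
    · intro x hx
      refine (iSup₂_le fun ν hν y hy => ?_ :
        _ ≤ (⨆ (ν : F) (_ : ν ∈ l), A.eigenspace ν).comap A) hx
      rw [Submodule.mem_comap, Module.End.mem_eigenspace_iff.1 hy]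
      exact Submodule.smul_mem _ _ (le_iSup₂ (f := fun ν (_ : ν ∈ l) => A.eigenspace ν) ν hν hy)
    · intro x hx
      refine (iSup₂_le fun ν hν y hy => ?_ :
        _ ≤ (⨆ (ν : F) (_ : ν ∈ l), A.eigenspace ν).comap As) hx
      rw [Submodule.mem_comap]
      refine SetLike.le_def.1 (iSup₂_le fun κ hκ => ?_) (h.apply_mem hq hA hy)
      by_cases hκe : A.HasEigenvalue κ
      · refine le_iSup₂_of_le κ ?_ le_rfl
        rcases hκ with rfl | hκ
        · exact hν
        · exact hcl ν hν κ hκe hκ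
      · rw [Module.End.hasEigenvalue_iff, not_not] at hκe
        rw [hκe]; exact bot_le
    · intro hbot
      obtain ⟨ν, hν⟩ := List.exists_mem_of_ne_nil l hne
      exact hev ν hν (le_bot_iff.1 (hbot ▸ le_iSup₂_of_le ν hν le_rfl))
  have hall : ∀ μ, A.HasEigenvalue μ → μ ∈ l := by
    intro μ hμ
    by_contra hμl
    have hdis := A.eigenspaces_iSupIndep.disjoint_biSup (x := μ) (y := {ν | ν ∈ l}) hμl
    have htop' : ⨆ i ∈ {ν | ν ∈ l}, A.eigenspace i = ⊤ := htop
    rw [htop', disjoint_top] at hdis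
    exact hμ hdis
  obtain ⟨d, hd⟩ : ∃ d, l.length = d + 1 :=
    Nat.exists_eq_succ_of_ne_zero (List.length_pos_iff.2 hne).ne'
  refine ⟨d, ?_, fun i => l[(i : ℕ)]'(by omega), ⟨?_, ?_⟩, ?_⟩
  -- With a single eigenvalue `A` is scalar, and an eigenvector of `A*` spans an invariant line,
  -- contradicting dimension at least 2.
  · by_contra! hd0
    obtain ⟨ν, rfl⟩ := List.length_eq_one_iff.1 (show l.length = 1 by omega)
    have hAν : ∀ x, A x = ν • x := fun x => Module.End.mem_eigenspace_iff.1 (by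
      have hx : x ∈ ⨆ (κ : F) (_ : κ ∈ [ν]), A.eigenspace κ := by rw [htop]; trivial
      simpa using hx)
    obtain ⟨μ, hμ⟩ := hAs.exists_hasEigenvalue
    obtain ⟨x, hx, hx0⟩ := hμ.exists_hasEigenvector
    have hx' : As x = μ • x := Module.End.mem_eigenspace_iff.1 hx
    have hspan := hirr (F ∙ x)
      (fun y hy => by rw [hAν]; exact Submodule.smul_mem _ _ hy)
      (fun y hy => by
        obtain ⟨c, rfl⟩ := Submodule.mem_span_singleton.1 hy
        rw [map_smul, hx', smul_comm]
        exact Submodule.smul_mem _ _ hy)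
    have hspan' := hspan.resolve_left (by simpa using hx0)
    have h2 := finrank_span_singleton (K := F) hx0
    rw [hspan', finrank_top] at h2
    omega
  · intro i j hij
    exact Fin.ext (hnd.getElem_inj_iff.1 hij)
  · intro x
    constructor
    · intro hx
      obtain ⟨i, hi, rfl⟩ := List.getElem_of_mem (hall x hx)
      exact ⟨⟨i, by omega⟩, rfl⟩
    · rintro ⟨i, rfl⟩
      exact hev _ (List.getElem_mem _)
  · intro i
    exact List.isChain_iff_getElem.1 hch i (by omega)

/-- The scalar `a q^(d-2z) + a⁻¹ q^(2z-d)`. -/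
def racahEigenvalue (q a : F) (d : ℕ) (z : ℤ) : F :=
  a * q ^ ((d : ℤ) - 2 * z) + a⁻¹ * q ^ (2 * z - (d : ℤ))

lemma sq_sub_inv_sq_ne_zero {q : F} (hq : q ≠ 0) (hq_root : ∀ n : ℕ, 0 < n → q ^ n ≠ 1) :
    q ^ 2 - q⁻¹ ^ 2 ≠ 0 := fun h => hq_root 4 (by norm_num) (by
  field_simp at h
  linear_combination h)

/-- Subtracting consecutive adjacency equations and cancelling `θ_(n+2) - θ_n` leaves a linear
recurrence with characteristic roots `q²`, `q⁻²`. The first adjacency equation says that the two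
coefficients have product 1. -/
lemma exists_racahEigenvalue {q : F} (hq : q ≠ 0) (hq_root : ∀ n : ℕ, 0 < n → q ^ n ≠ 1)
    (hd : 1 ≤ d) {θ : Fin (d + 1) → F} (hinj : Function.Injective θ)
    (hadj : ∀ i : Fin d, Adjacent q (θ i.castSucc) (θ i.succ)) :
    ∃ a : F, a ≠ 0 ∧ ∀ i : Fin (d + 1), θ i = racahEigenvalue q a d i := by
  have he := sq_sub_inv_sq_ne_zero hq hq_root
  have hD : q ^ (d : ℤ) ≠ 0 := zpow_ne_zero _ hq
  set x := θ 0
  set y := θ ⟨1, by omega⟩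
  have hxy : Adjacent q x y := hadj ⟨0, by omega⟩
  -- The solution of `x = u + v`, `y = u q⁻² + v q²`.
  set u := (q ^ 2 * x - y) / (q ^ 2 - q⁻¹ ^ 2) with hu
  set v := (y - q⁻¹ ^ 2 * x) / (q ^ 2 - q⁻¹ ^ 2) with hv
  have huv : u * v = 1 := by
    have h2 := hxy.2
    rw [hu, hv, div_mul_div_comm, div_eq_one_iff_eq (mul_ne_zero he he)]
    have : q ^ 2 * q⁻¹ ^ 2 = 1 := by field_simp
    linear_combination (-1 : F) * h2 - x ^ 2 * this
  have hu0 : u ≠ 0 := left_ne_zero_of_mul_eq_one huv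
  have hvu : v = u⁻¹ := eq_inv_of_mul_eq_one_right huv
  have hx : x = u + v := by rw [hu, hv, ← add_div, eq_div_iff he]; ring
  have hy : y = u * q⁻¹ ^ 2 + v * q ^ 2 := by
    rw [hu, hv, div_mul_eq_mul_div, div_mul_eq_mul_div, ← add_div, eq_div_iff he]; ring
  refine ⟨u * (q ^ (d : ℤ))⁻¹, mul_ne_zero hu0 (inv_ne_zero hD), ?_⟩
  have hform : ∀ n : ℕ, racahEigenvalue q (u * (q ^ (d : ℤ))⁻¹) d n =
      u * (q⁻¹ ^ 2) ^ n + v * (q ^ 2) ^ n := by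
    intro n
    rw [racahEigenvalue, hvu, zpow_sub₀ hq, zpow_sub₀ hq, zpow_mul, zpow_natCast (q ^ (2 : ℤ)),
      zpow_ofNat, inv_pow, inv_pow]
    field_simp
  have key : ∀ n : ℕ, ∀ hn : n < d + 1,
      θ ⟨n, hn⟩ = u * (q⁻¹ ^ 2) ^ n + v * (q ^ 2) ^ n := by
    intro n
    induction n using Nat.strong_induction_on with
    | _ n ih =>
      intro hn
      match n, ih, hn with
      | 0, _, _ => simpa using hx
      | 1, _, _ => simpa using hy
      | n + 2, ih, hn =>
        have h0 := ih n (by omega) (by omega)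
        have h1 := ih (n + 1) (by omega) (by omega)
        have a0 : Adjacent q (θ ⟨n, by omega⟩) (θ ⟨n + 1, by omega⟩) := hadj ⟨n, by omega⟩
        have a1 : Adjacent q (θ ⟨n + 1, by omega⟩) (θ ⟨n + 2, hn⟩) := hadj ⟨n + 1, by omega⟩
        have hne : θ ⟨n + 2, hn⟩ - θ ⟨n, by omega⟩ ≠ 0 := sub_ne_zero.2 fun h => by
          have := congrArg Fin.val (hinj h)
          simp at this
        have e : (θ ⟨n + 2, hn⟩ - θ ⟨n, by omega⟩) * (θ ⟨n + 2, hn⟩ + θ ⟨n, by omega⟩ -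
            (q ^ 2 + q⁻¹ ^ 2) * θ ⟨n + 1, by omega⟩) = 0 := by
          linear_combination a1.2 - a0.2
        have e' := (mul_eq_zero.1 e).resolve_left hne
        have hqq : q ^ 2 * q⁻¹ ^ 2 = 1 := by field_simp
        rw [h0, h1] at e'
        linear_combination e' + (u * (q⁻¹ ^ 2) ^ n + v * (q ^ 2) ^ n) * hqq
  intro i
  rw [hform, ← key i i.2]

/-- The difference of the two values vanishes with `(q^(2s) - q^(2r)) (a² q^(2d) - q^(2r+2s))`. -/
lemma racahEigenvalue_eq {q a : F} (hq : q ≠ 0) (hq_root : ∀ n : ℕ, 0 < n → q ^ n ≠ 1)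
    (ha : a ≠ 0) {r s : ℤ} (h : racahEigenvalue q a d r = racahEigenvalue q a d s) :
    r = s ∨ a ^ 2 = q ^ (2 * (r + s - d)) := by
  have hx : q ^ r ≠ 0 := zpow_ne_zero _ hq
  have hy : q ^ s ≠ 0 := zpow_ne_zero _ hq
  have hD : q ^ (d : ℤ) ≠ 0 := zpow_ne_zero _ hq
  have h2 : ∀ z : ℤ, q ^ (2 * z) = (q ^ z) ^ 2 := fun z => by
    rw [mul_comm, zpow_mul, zpow_ofNat]
  have hprod : ((q ^ s) ^ 2 - (q ^ r) ^ 2) *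
      (a ^ 2 * (q ^ (d : ℤ)) ^ 2 - (q ^ r) ^ 2 * (q ^ s) ^ 2) = 0 := by
    simp only [racahEigenvalue, zpow_sub₀ hq, h2] at h
    field_simp at h
    linear_combination h
  rcases mul_eq_zero.1 hprod with h1 | h1
  · left
    rw [sub_eq_zero, ← h2, ← h2] at h1
    have := zpow_injective_of_pow_ne_one hq hq_root h1
    omega
  · right
    rw [h2, zpow_sub₀ hq, zpow_add₀ hq]
    field_simp
    linear_combination h1

/-- `P(θ_r, y) = (y - θ_(r+1)) (y - θ_(r-1))`, with `θ` extended by its formula to all integers. -/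
lemma racahEigenvalue_adjacent {q a : F} (hq : q ≠ 0) (ha : a ≠ 0) {r : ℤ} {y : F}
    (h : Adjacent q (racahEigenvalue q a d r) y) :
    y = racahEigenvalue q a d (r + 1) ∨ y = racahEigenvalue q a d (r - 1) := by
  have hx : q ^ r ≠ 0 := zpow_ne_zero _ hq
  have hD : q ^ (d : ℤ) ≠ 0 := zpow_ne_zero _ hq
  have h2 : ∀ z : ℤ, q ^ (2 * z) = (q ^ z) ^ 2 := fun z => by
    rw [mul_comm, zpow_mul, zpow_ofNat]
  rw [← sub_eq_zero, ← sub_eq_zero (a := y) (b := racahEigenvalue q a d (r - 1)), ← mul_eq_zero,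
    ← h.2]
  simp only [racahEigenvalue, zpow_sub₀ hq, h2, zpow_add₀ hq, zpow_one]
  field_simp
  ring

lemma threeTerm_of_dolanGradyRel [FiniteDimensional F V] {q a : F} (hq : q ≠ 0)
    (hq_root : ∀ n : ℕ, 0 < n → q ^ n ≠ 1) {A As : Module.End F V} (h : DolanGradyRel q A As)
    (hA : Diagonalizable A) {θ : Fin (d + 1) → F} (hθ : IsEigenvalueOrdering A θ) (ha : a ≠ 0)
    (hform : ∀ i : Fin (d + 1), θ i = racahEigenvalue q a d i) :
    ThreeTerm As (eigenspaces A θ) := by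
  -- The coincidence `a² = q^(2m)` would identify `θ_i` and `θ_j` whenever `i + j = d + m`; for `|m|
  -- < d` some such pair is distinct and in range.
  have hfold : ∀ m : ℤ, m < d → -m < d → a ^ 2 ≠ q ^ (2 * m) := by
    intro m hm hm' he
    obtain ⟨i, j, hij, hi, hj, hijm⟩ :
        ∃ i j : ℕ, i ≠ j ∧ i < d + 1 ∧ j < d + 1 ∧ (i : ℤ) + j - d = m := by
      rcases le_total 0 m with h0 | h0
      · exact ⟨d, m.toNat, by omega, by omega, by omega, by omega⟩
      · exact ⟨0, (m + d).toNat, by omega, by omega, by omega, by omega⟩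
    refine hij (congrArg Fin.val (hθ.1 (a₁ := ⟨i, hi⟩) (a₂ := ⟨j, hj⟩) ?_))
    rw [hform, hform]
    have hx : q ^ (i : ℤ) ≠ 0 := zpow_ne_zero _ hq
    have hy : q ^ (j : ℤ) ≠ 0 := zpow_ne_zero _ hq
    have hD : q ^ (d : ℤ) ≠ 0 := zpow_ne_zero _ hq
    have h2 : ∀ z : ℤ, q ^ (2 * z) = (q ^ z) ^ 2 := fun z => by
      rw [mul_comm, zpow_mul, zpow_ofNat]
    rw [← hijm, h2, zpow_sub₀ hq, zpow_add₀ hq, div_pow, eq_div_iff (pow_ne_zero _ hD)] at he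
    simp only [racahEigenvalue, zpow_sub₀ hq, h2]
    field_simp
    linear_combination ((q ^ (j : ℤ)) ^ 2 - (q ^ (i : ℤ)) ^ 2) * he
  -- The neighbour `r` may be `-1` or `d + 1` and still give an eigenvalue `θ_j`. If `|i - j| ≥ 2`,
  -- then `0 < j + r < 2d`, which `hfold` excludes.
  have hstep : ∀ i j : Fin (d + 1), ∀ r : ℤ, (r = i + 1 ∨ r = i - 1) →
      θ j = racahEigenvalue q a d r → (j : ℕ) ≤ i + 1 ∧ (i : ℕ) ≤ j + 1 := by
    intro i j r hr hj
    rw [hform] at hj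
    rcases racahEigenvalue_eq hq hq_root ha hj with h1 | h1
    · omega
    · by_contra hcon
      refine hfold _ ?_ ?_ h1 <;> omega
  rintro i _ ⟨x, hx, rfl⟩
  refine SetLike.le_def.1 (iSup₂_le fun ν hν => ?_) (h.apply_mem hq hA hx)
  by_cases hνe : A.HasEigenvalue ν
  · obtain ⟨j, rfl⟩ := (hθ.2 ν).1 hνe
    refine le_iSup₂_of_le j ?_ le_rfl
    rcases hν with hν | hν
    · rw [hθ.1 hν]; omega
    · rw [hform i] at hν
      rcases racahEigenvalue_adjacent hq ha hν with h1 | h1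
      · exact hstep i j _ (Or.inl rfl) h1
      · exact hstep i j _ (Or.inr rfl) h1
  · rw [Module.End.hasEigenvalue_iff, not_not] at hνe
    rw [hνe]; exact bot_le

end Ordering

/-! ### The Lusztig automorphism as a conjugation -/

section Lusztig

variable {F : Type*} [Field F] {V : Type*} [AddCommGroup V] [Module F V] {d : ℕ}

/-- The eigenvalue, on the eigenspace of `A` for `racahEigenvalue q a d n`, of the operator that
implements the Lusztig automorphism. -/
def lusztigWeight (q a : F) (d : ℕ) (n : ℤ) : F := a ^ (-2 * n) * q ^ (2 * n * (n - d))

lemma zpow_two_mul_eq_sq (q : F) (z : ℤ) : q ^ (2 * z) = (q ^ z) ^ 2 := by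
  rw [mul_comm, zpow_mul, zpow_ofNat]

lemma lusztigWeight_ne_zero {q a : F} (hq : q ≠ 0) (ha : a ≠ 0) (n : ℤ) :
    lusztigWeight q a d n ≠ 0 :=
  mul_ne_zero (zpow_ne_zero _ ha) (zpow_ne_zero _ hq)

lemma lusztigWeight_succ {q a : F} (hq : q ≠ 0) (ha : a ≠ 0) (n : ℤ) :
    lusztigWeight q a d (n + 1) =
      lusztigWeight q a d n * ((q ^ n) ^ 4 * q ^ 2 / (a ^ 2 * (q ^ (d : ℤ)) ^ 2)) := by
  have h1 : a ^ (-2 * (n + 1)) = a ^ (-2 * n) * (a ^ 2)⁻¹ := by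
    rw [mul_add, zpow_add₀ ha, mul_one, zpow_neg, zpow_ofNat]
  have h2 : q ^ (2 * (n + 1) * (n + 1 - d)) =
      q ^ (2 * n * (n - d)) * ((q ^ n) ^ 4 * q ^ 2 / (q ^ (d : ℤ)) ^ 2) := by
    rw [show 2 * (n + 1) * (n + 1 - d) = 2 * n * (n - d) + (n * 4 + 2 - d * 2) by ring,
      zpow_add₀ hq, zpow_sub₀ hq, zpow_add₀ hq, zpow_mul q n, zpow_mul q (d : ℤ)]
    simp only [zpow_ofNat]
  rw [lusztigWeight, lusztigWeight, h1, h2]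
  field_simp

lemma racahEigenvalue_eq_div {q : F} (hq : q ≠ 0) (a : F) (n : ℤ) :
    racahEigenvalue q a d n =
      a * (q ^ (d : ℤ) / (q ^ n) ^ 2) + a⁻¹ * ((q ^ n) ^ 2 / q ^ (d : ℤ)) := by
  simp only [racahEigenvalue, zpow_sub₀ hq, zpow_two_mul_eq_sq]

lemma q_sub_inv_ne_zero {q : F} (hq : q ≠ 0) (hq_root : ∀ n : ℕ, 0 < n → q ^ n ≠ 1) :
    q - q⁻¹ ≠ 0 := fun h => hq_root 2 (by norm_num) (by
  field_simp at h
  linear_combination h)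

/-- On the component of `A*` from `V_n` to `V_(n+1)`, passing to `L(A*)` multiplies by the bracketed
factor, which must equal `t_(n+1) / t_n`. The next such identity treats the opposite direction. -/
lemma lusztig_scalar_succ {q a : F} (hq : q ≠ 0) (hq_root : ∀ n : ℕ, 0 < n → q ^ n ≠ 1)
    (ha : a ≠ 0) (n : ℤ) :
    lusztigWeight q a d n * (1 + ((q - q⁻¹) * (q ^ 2 - q⁻¹ ^ 2))⁻¹ *
      ((racahEigenvalue q a d (n + 1) - racahEigenvalue q a d n) *
        (q * racahEigenvalue q a d (n + 1) - q⁻¹ * racahEigenvalue q a d n))) =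
      lusztigWeight q a d (n + 1) := by
  have h1 := q_sub_inv_ne_zero hq hq_root
  have h2 := sq_sub_inv_sq_ne_zero hq hq_root
  have hx : q ^ n ≠ 0 := zpow_ne_zero _ hq
  have hD : q ^ (d : ℤ) ≠ 0 := zpow_ne_zero _ hq
  rw [lusztigWeight_succ hq ha]
  congr 1
  rw [← eq_sub_iff_add_eq', inv_mul_eq_iff_eq_mul₀ (mul_ne_zero h1 h2),
    racahEigenvalue_eq_div hq, racahEigenvalue_eq_div hq, zpow_add₀ hq, zpow_one]
  field_simp
  ring

lemma lusztig_scalar_pred {q a : F} (hq : q ≠ 0) (hq_root : ∀ n : ℕ, 0 < n → q ^ n ≠ 1)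
    (ha : a ≠ 0) (n : ℤ) :
    lusztigWeight q a d (n + 1) * (1 + ((q - q⁻¹) * (q ^ 2 - q⁻¹ ^ 2))⁻¹ *
      ((racahEigenvalue q a d n - racahEigenvalue q a d (n + 1)) *
        (q * racahEigenvalue q a d n - q⁻¹ * racahEigenvalue q a d (n + 1)))) =
      lusztigWeight q a d n := by
  have h1 := q_sub_inv_ne_zero hq hq_root
  have h2 := sq_sub_inv_sq_ne_zero hq hq_root
  have hx : q ^ n ≠ 0 := zpow_ne_zero _ hq
  have hD : q ^ (d : ℤ) ≠ 0 := zpow_ne_zero _ hq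
  rw [lusztigWeight_succ hq ha, mul_assoc]
  refine mul_eq_left₀ (lusztigWeight_ne_zero hq ha n) |>.2 ?_
  rw [mul_comm, ← eq_div_iff (div_ne_zero (mul_ne_zero (pow_ne_zero _ hx) (pow_ne_zero _ hq)) (mul_ne_zero (pow_ne_zero _ ha) (pow_ne_zero _ hD))), ← eq_sub_iff_add_eq',
    inv_mul_eq_iff_eq_mul₀ (mul_ne_zero h1 h2),
    racahEigenvalue_eq_div hq, racahEigenvalue_eq_div hq, zpow_add₀ hq, zpow_one]
  field_simp
  ring

/-- The action of the image of `A*` under the Lusztig automorphism. -/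
def lusztigOp (q : F) (A As : Module.End F V) : Module.End F V :=
  As + ((q - q⁻¹) * (q ^ 2 - q⁻¹ ^ 2))⁻¹ • bracket A (qBracket q A As)

/-- A tridiagonal system of `q`-Racah type, with the eigenvalues of `A` in closed form. -/
structure RacahSystem (q a : F) (A As : Module.End F V) (θ θs : Fin (d + 1) → F) : Prop where
  decomp : IsDecomposition (eigenspaces A θ)
  decomp_star : IsDecomposition (eigenspaces As θs)
  injective_star : Function.Injective θs
  form : ∀ i : Fin (d + 1), θ i = racahEigenvalue q a d i
  threeTerm : ThreeTerm A (eigenspaces As θs)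
  threeTerm_star : ThreeTerm As (eigenspaces A θ)

namespace RacahSystem

variable {q a : F} {A As : Module.End F V} {θ θs : Fin (d + 1) → F}

/-- The closed form is invariant under `a ↦ a⁻¹`, `z ↦ d - z`. As `L(A*)` does not depend on the
ordering, one arrow yields the others. -/
lemma flip (h : RacahSystem q a A As θ θs) : RacahSystem q a⁻¹ A As (θ ∘ Fin.rev) θs where
  decomp := h.decomp.inversion
  decomp_star := h.decomp_star
  injective_star := h.injective_star
  form i := by
    have hi : ((i.rev : ℕ) : ℤ) = d - (i : ℕ) := by rw [Fin.val_rev]; omega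
    rw [Function.comp_apply, h.form, racahEigenvalue, racahEigenvalue, hi, inv_inv, add_comm]
    congr 3 <;> ring
  threeTerm := h.threeTerm
  threeTerm_star := h.threeTerm_star.inversion

lemma flip_star (h : RacahSystem q a A As θ θs) : RacahSystem q a A As θ (θs ∘ Fin.rev) where
  decomp := h.decomp
  decomp_star := h.decomp_star.inversion
  injective_star := h.injective_star.comp Fin.rev_injective
  form := h.form
  threeTerm := h.threeTerm.inversion
  threeTerm_star := h.threeTerm_star

lemma exists_lusztig_conjugation (h : RacahSystem q a A As θ θs) (hq : q ≠ 0)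
    (hq_root : ∀ n : ℕ, 0 < n → q ^ n ≠ 1) (ha : a ≠ 0) :
    ∃ H : (Module.End F V)ˣ,
      (∀ i : Fin (d + 1), ∀ x ∈ eigenspaces A θ i,
        (H : Module.End F V) x = lusztigWeight q a d i • x) ∧
      (∀ x, (H : Module.End F V) (A x) = A ((H : Module.End F V) x)) ∧
      ∀ x, (H : Module.End F V) (As x) = lusztigOp q A As ((H : Module.End F V) x) := by
  have htop := (isDecomposition_iff.1 h.decomp).2.2
  obtain ⟨H, hH⟩ := exists_linearMap_of_isInternal h.decomp.2
    fun i => lusztigWeight q a d (i : ℕ)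
  obtain ⟨H', hH'⟩ := exists_linearMap_of_isInternal h.decomp.2
    fun i => (lusztigWeight q a d (i : ℕ))⁻¹
  have hne : ∀ i : Fin (d + 1), lusztigWeight q a d (i : ℕ) ≠ 0 :=
    fun i => lusztigWeight_ne_zero hq ha _
  have h1 : H * H' = 1 := ext_of_iSup_eq_top htop fun i x hx => by
    rw [Module.End.mul_apply, hH' i x hx, map_smul, hH i x hx, smul_smul, inv_mul_cancel₀ (hne i),
      one_smul, Module.End.one_apply]
  have h2 : H' * H = 1 := ext_of_iSup_eq_top htop fun i x hx => by
    rw [Module.End.mul_apply, hH i x hx, map_smul, hH' i x hx, smul_smul, mul_inv_cancel₀ (hne i),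
      one_smul, Module.End.one_apply]
  have hA : ∀ i, ∀ x ∈ eigenspaces A θ i, A x = θ i • x :=
    fun i x hx => Module.End.mem_eigenspace_iff.1 hx
  refine ⟨⟨H, H', h1, h2⟩, hH, ?_, ?_⟩
  · have : H * A = A * H := ext_of_iSup_eq_top htop fun i x hx => by
      rw [Module.End.mul_apply, Module.End.mul_apply, hA i x hx, map_smul, hH i x hx, map_smul,
        hA i x hx, smul_comm]
    exact fun x => LinearMap.congr_fun this x
  · have : H * As = lusztigOp q A As * H := ext_of_iSup_eq_top htop fun j x hx => by
      rw [Module.End.mul_apply, Module.End.mul_apply, hH j x hx, map_smul]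
      set c := ((q - q⁻¹) * (q ^ 2 - q⁻¹ ^ 2))⁻¹ with hc
      have hL : lusztigOp q A As x = As x + c • (q • A (A (As x)) - (q⁻¹ * θ j) • A (As x) -
          (q * θ j) • A (As x) + (q⁻¹ * θ j * θ j) • As x) := by
        simp only [lusztigOp, bracket, qBracket, LinearMap.add_apply, LinearMap.sub_apply,
          LinearMap.smul_apply, Module.End.mul_apply, hA j x hx, map_sub, map_smul, ← hc]
        module
      rw [hL]
      have hy := h.threeTerm_star j (Submodule.mem_map_of_mem hx)
      -- Only the membership of `A* x` in `V_(j-1) + V_j + V_(j+1)` matters. On these eigenspaces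
      -- `H` is compared with a polynomial `R` in `A`, one scalar at a time.
      generalize As x = y at hy
      let R : Module.End F V := lusztigWeight q a d (j : ℕ) • (1 + c • (q • (A * A) -
        (q⁻¹ * θ j) • A - (q * θ j) • A + (q⁻¹ * θ j * θ j) • 1))
      suffices hle : (⨆ (i : Fin (d + 1)) (_ : (i : ℕ) ≤ (j : ℕ) + 1 ∧ (j : ℕ) ≤ (i : ℕ) + 1),
          eigenspaces A θ i) ≤ LinearMap.eqLocus H R by
        have := hle hy
        rw [LinearMap.mem_eqLocus] at this
        simpa [R] using this
      refine iSup₂_le fun i hi z hz => ?_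
      rw [LinearMap.mem_eqLocus, hH i z hz]
      have hR : R z = (lusztigWeight q a d (j : ℕ) *
          (1 + c * ((θ i - θ j) * (q * θ i - q⁻¹ * θ j)))) • z := by
        simp only [R, LinearMap.add_apply, LinearMap.sub_apply, LinearMap.smul_apply,
          Module.End.mul_apply, Module.End.one_apply, hA i z hz, map_smul]
        module
      rw [hR]
      congr 1
      rw [h.form, h.form]
      obtain hij | hij | hij : (i : ℕ) = j ∨ (i : ℕ) = j + 1 ∨ (j : ℕ) = i + 1 := by omega
      · rw [hij]; ring
      · rw [hij, Nat.cast_succ, hc, lusztig_scalar_succ hq hq_root ha]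
      · rw [hij, Nat.cast_succ, hc, lusztig_scalar_pred hq hq_root ha]
    exact fun x => LinearMap.congr_fun this x

end RacahSystem

end Lusztig

/-! ### Descending products and their coefficients -/

section Descent

variable {F : Type*} [Field F] {V : Type*} [AddCommGroup V] [Module F V] {d : ℕ}

/-- The product `(A - τ (n-k+1)) ⋯ (A - τ n)`. -/
def descend (A : Module.End F V) (τ : ℤ → F) : ℤ → ℕ → V → V
  | _, 0, x => x
  | n, k + 1, x => descend A τ (n - 1) k (A x - τ n • x)

lemma apply_descend (A : Module.End F V) (τ : ℤ → F) (n : ℤ) (k : ℕ) (x : V) :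
    A (descend A τ n k x) = τ (n - k) • descend A τ n k x + descend A τ n (k + 1) x := by
  induction k generalizing n x with
  | zero => simp [descend]
  | succ k ih =>
    rw [descend, ih, descend.eq_def A τ n (k + 1 + 1)]
    simp only [Nat.cast_succ]
    rw [show n - ((k : ℤ) + 1) = n - 1 - k by ring]

/-- The scalar `q^(2z-d)`. -/
def weightScalar (q : F) (d : ℕ) (z : ℤ) : F := q ^ (2 * z - (d : ℤ))

lemma weightScalar_ne_zero {q : F} (hq : q ≠ 0) (z : ℤ) : weightScalar q d z ≠ 0 :=
  zpow_ne_zero _ hq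

lemma weightScalar_sub_ne_zero {q : F} (hq : q ≠ 0) (hq_root : ∀ n : ℕ, 0 < n → q ^ n ≠ 1)
    {r s : ℤ} (h : r ≠ s) : weightScalar q d r - weightScalar q d s ≠ 0 :=
  sub_ne_zero.2 fun he => h (by have := zpow_injective_of_pow_ne_one hq hq_root he; omega)

lemma weightScalar_pred {q : F} (hq : q ≠ 0) (z : ℤ) :
    weightScalar q d (z - 1) = weightScalar q d z * (q ^ 2)⁻¹ := by
  rw [weightScalar, weightScalar, show 2 * (z - 1) - (d : ℤ) = 2 * z - d - 2 by ring,
    zpow_sub₀ hq, div_eq_mul_inv, zpow_ofNat]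

lemma racahEigenvalue_eq_weightScalar (q a : F) (z : ℤ) :
    racahEigenvalue q a d z = a * (weightScalar q d z)⁻¹ + a⁻¹ * weightScalar q d z := by
  rw [racahEigenvalue, weightScalar, ← zpow_neg, neg_sub]

lemma lusztigWeight_pred {q a : F} (hq : q ≠ 0) (ha : a ≠ 0) (n : ℤ) :
    lusztigWeight q a d (n - 1) = lusztigWeight q a d n *
      (a ^ 2 * (weightScalar q d n * weightScalar q d (n - 1))⁻¹) := by
  have hn : q ^ n ≠ 0 := zpow_ne_zero _ hq
  have hD : q ^ (d : ℤ) ≠ 0 := zpow_ne_zero _ hq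
  have h := lusztigWeight_succ (d := d) hq ha (n - 1)
  rw [sub_add_cancel] at h
  rw [h, mul_assoc, eq_comm]
  refine mul_eq_left₀ (lusztigWeight_ne_zero hq ha _) |>.2 ?_
  rw [weightScalar_pred hq, weightScalar, zpow_sub₀ hq, zpow_sub₀ hq, zpow_one,
    zpow_two_mul_eq_sq]
  field_simp

/-- The coefficients in the expansion of the conjugating operator along a split decomposition. -/
def descentCoeff (q a : F) (d : ℕ) (n : ℤ) : ℕ → F
  | 0 => lusztigWeight q a d n
  | k + 1 => descentCoeff q a d n k * a /
      (weightScalar q d n - weightScalar q d (n - (k + 1 : ℕ)))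

variable {q a : F}

lemma descentCoeff_succ_mul (hq : q ≠ 0) (hq_root : ∀ n : ℕ, 0 < n → q ^ n ≠ 1) (n : ℤ) (k : ℕ) :
    descentCoeff q a d n (k + 1) * (weightScalar q d n - weightScalar q d (n - (k + 1 : ℕ))) =
      descentCoeff q a d n k * a :=
  div_mul_cancel₀ _ (weightScalar_sub_ne_zero hq hq_root (by omega))

/-- In `c_k = t_n a^k / ∏ (s_n - s_(n-j))`, lowering `n` by one multiplies each factor of the
denominator by `q⁻²`; the change of `t_n` is the case `k = 0`. -/
lemma descentCoeff_pred (hq : q ≠ 0) (hq_root : ∀ n : ℕ, 0 < n → q ^ n ≠ 1) (ha : a ≠ 0) (n : ℤ)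
    (k : ℕ) :
    descentCoeff q a d (n - 1) k = descentCoeff q a d n k *
      (a ^ 2 * (weightScalar q d n * weightScalar q d (n - (k + 1 : ℕ)))⁻¹) := by
  induction k with
  | zero => exact lusztigWeight_pred hq ha n
  | succ k ih =>
    have h0 : weightScalar q d n - weightScalar q d (n - (k + 1 : ℕ)) ≠ 0 :=
      weightScalar_sub_ne_zero hq hq_root (by omega)
    have hn := weightScalar_ne_zero (d := d) hq n
    have hk := weightScalar_ne_zero (d := d) hq (n - (k + 1 : ℕ))
    rw [descentCoeff, descentCoeff, ih, weightScalar_pred hq,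
      show n - 1 - ((k + 1 : ℕ) : ℤ) = n - (k + 1 : ℕ) - 1 by ring,
      show n - ((k + 1 + 1 : ℕ) : ℤ) = n - (k + 1 : ℕ) - 1 by push_cast; ring,
      weightScalar_pred hq, ← sub_mul]
    field_simp

/-- This is `(A - θ_n) H x = H (A - θ_n) x` read off at `w_(k+1)`. It holds since `θ_m - θ_n = (s_n
- s_m) (a / (s_n s_m) - a⁻¹)`, whose first factor cancels the denominator. -/
lemma descentCoeff_recurrence (hq : q ≠ 0) (hq_root : ∀ n : ℕ, 0 < n → q ^ n ≠ 1) (ha : a ≠ 0)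
    (n : ℤ) (k : ℕ) :
    descentCoeff q a d n (k + 1) *
        (racahEigenvalue q a d (n - (k + 1 : ℕ)) - racahEigenvalue q a d n) +
      descentCoeff q a d n k = descentCoeff q a d (n - 1) k := by
  have h0 : weightScalar q d n - weightScalar q d (n - (k + 1 : ℕ)) ≠ 0 :=
    weightScalar_sub_ne_zero hq hq_root (by omega)
  have hn := weightScalar_ne_zero (d := d) hq n
  have hk := weightScalar_ne_zero (d := d) hq (n - (k + 1 : ℕ))
  rw [descentCoeff_pred hq hq_root ha, descentCoeff, racahEigenvalue_eq_weightScalar,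
    racahEigenvalue_eq_weightScalar]
  field_simp
  ring

end Descent

/-! ### The conjugating operator on a split decomposition -/

namespace RacahSystem

variable {F : Type*} [Field F] {V : Type*} [AddCommGroup V] [Module F V] {d : ℕ}
  {q a : F} {A As : Module.End F V} {θ θs : Fin (d + 1) → F}

/-- The summand `(V*_0 + ⋯ + V*_{d-n}) ∩ (V_0 + ⋯ + V_n)` of the split decomposition. -/
def splitSpace (A As : Module.End F V) (θ θs : Fin (d + 1) → F) (n : ℕ) : Submodule F V :=
  lowerSum (eigenspaces As θs) (d + 1 - n) ⊓ lowerSum (eigenspaces A θ) (n + 1)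

/-- `A` raises the flag of `A*` by one step, while subtracting the eigenvalue lowers the flag of `A`
by one. -/
lemma sub_mem_splitSpace (h : RacahSystem q a A As θ θs) {n : ℕ} (hn : n + 1 ≤ d) {x : V}
    (hx : x ∈ splitSpace A As θ θs (n + 1)) :
    A x - racahEigenvalue q a d ((n + 1 : ℕ) : ℤ) • x ∈ splitSpace A As θ θs n := by
  refine ⟨sub_mem ?_ (Submodule.smul_mem _ _ (lowerSum_mono _ (by omega) hx.1)), ?_⟩
  · have := h.threeTerm.apply_mem_lowerSum hx.1
    rwa [show d + 1 - (n + 1) + 1 = d + 1 - n by omega] at this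
  · rw [← h.form ⟨n + 1, by omega⟩]
    exact mem_lowerSum_eigenspaces_sub (θ := θ) ⟨n + 1, by omega⟩ hx.2

lemma sub_eq_zero_of_mem_splitSpace (h : RacahSystem q a A As θ θs) {x : V}
    (hx : x ∈ splitSpace A As θ θs 0) : A x - racahEigenvalue q a d 0 • x = 0 := by
  have h0 := mem_lowerSum_eigenspaces_sub (θ := θ) 0 hx.2
  rw [h.form] at h0
  simpa using h0

lemma descend_mem_splitSpace (h : RacahSystem q a A As θ θs) {n k : ℕ} (hn : n ≤ d) (hk : k ≤ n)
    {x : V} (hx : x ∈ splitSpace A As θ θs n) :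
    descend A (racahEigenvalue q a d) n k x ∈ splitSpace A As θ θs (n - k) := by
  induction k generalizing n x with
  | zero => exact hx
  | succ k ih =>
    obtain ⟨n, rfl⟩ := Nat.exists_eq_succ_of_ne_zero (show n ≠ 0 by omega)
    rw [descend]
    have := ih (n := n) (by omega) (by omega) (h.sub_mem_splitSpace hn hx)
    rwa [Nat.succ_eq_add_one, Nat.add_sub_add_right, Nat.cast_succ, add_sub_cancel_right]

lemma descend_eq_zero (h : RacahSystem q a A As θ θs) {n : ℕ} (hn : n ≤ d)
    {x : V} (hx : x ∈ splitSpace A As θ θs n) :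
    descend A (racahEigenvalue q a d) n (n + 1) x = 0 := by
  induction n generalizing x with
  | zero => exact h.sub_eq_zero_of_mem_splitSpace hx
  | succ n ih =>
    rw [descend]
    have := ih (by omega) (h.sub_mem_splitSpace hn hx)
    rwa [Nat.cast_succ, add_sub_cancel_right, ← Nat.cast_succ]

/-- The conjugating operator, expanded along the split decomposition. -/
lemma conjugation_eq_sum (h : RacahSystem q a A As θ θs) (hq : q ≠ 0)
    (hq_root : ∀ n : ℕ, 0 < n → q ^ n ≠ 1) (ha : a ≠ 0) {H : Module.End F V}
    (hH : ∀ i : Fin (d + 1), ∀ x ∈ eigenspaces A θ i, H x = lusztigWeight q a d i • x)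
    (hHA : ∀ x, H (A x) = A (H x)) {n : ℕ} (hn : n ≤ d) {x : V}
    (hx : x ∈ splitSpace A As θ θs n) :
    H x = ∑ k ∈ Finset.range (n + 1),
      descentCoeff q a d n k • descend A (racahEigenvalue q a d) n k x := by
  induction n generalizing x with
  | zero =>
    have hx0 : x ∈ eigenspaces A θ 0 := by
      have := hx.2
      rw [zero_add, show (1 : ℕ) = ((0 : Fin (d + 1)) : ℕ) + 1 from rfl, lowerSum_succ] at this
      simpa using this
    simpa [descentCoeff, descend] using hH 0 x hx0
  | succ n ih =>
    set τ := racahEigenvalue q a d with hτ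
    set c := descentCoeff q a d ((n + 1 : ℕ) : ℤ) with hc
    set w := fun k => descend A τ ((n + 1 : ℕ) : ℤ) k x with hw
    have hsub : (((n + 1 : ℕ) : ℤ)) - 1 = n := by push_cast; ring
    have hx1 : H (A x - τ ((n + 1 : ℕ) : ℤ) • x) =
        ∑ k ∈ Finset.range (n + 1), descentCoeff q a d n k • w (k + 1) := by
      rw [ih (by omega) (h.sub_mem_splitSpace hn hx)]
      refine Finset.sum_congr rfl fun k _ => ?_
      simp only [hw]
      rw [descend, hsub]
    have hw0 : w (n + 2) = 0 := h.descend_eq_zero hn hx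
    have hAw : ∀ k, A (w k) = τ (((n + 1 : ℕ) : ℤ) - k) • w k + w (k + 1) :=
      fun k => apply_descend A τ _ k x
    set S := ∑ k ∈ Finset.range (n + 1 + 1), c k • w k with hS
    have hAS : A S - τ ((n + 1 : ℕ) : ℤ) • S =
        ∑ k ∈ Finset.range (n + 1), descentCoeff q a d n k • w (k + 1) := by
      have e1 : A S - τ ((n + 1 : ℕ) : ℤ) • S = ∑ k ∈ Finset.range (n + 1 + 1),
          ((c k * (τ (((n + 1 : ℕ) : ℤ) - k) - τ ((n + 1 : ℕ) : ℤ))) • w k + c k • w (k + 1)) := by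
        rw [hS, map_sum, Finset.smul_sum, ← Finset.sum_sub_distrib]
        refine Finset.sum_congr rfl fun k _ => ?_
        rw [map_smul, hAw]
        module
      rw [e1, Finset.sum_add_distrib, Finset.sum_range_succ', Finset.sum_range_succ _ (n + 1), hw0,
        smul_zero, add_zero, Nat.cast_zero, sub_zero, sub_self, mul_zero, zero_smul, add_zero,
        ← Finset.sum_add_distrib]
      refine Finset.sum_congr rfl fun k _ => ?_
      rw [← add_smul, hc, hτ, descentCoeff_recurrence hq hq_root ha, hsub]
    -- By the induction hypothesis, `A - θ_(n+1)` takes the same value on `Hx` and on `S`.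
    have hz1 : H x - S ∈ eigenspaces A θ ⟨n + 1, by omega⟩ := by
      refine Module.End.mem_eigenspace_iff.2 ?_
      rw [h.form, ← sub_eq_zero]
      have : A (H x) - τ ((n + 1 : ℕ) : ℤ) • H x - (A S - τ ((n + 1 : ℕ) : ℤ) • S) = 0 := by
        rw [hAS, ← hx1, map_sub, map_smul, hHA, sub_self]
      rw [← this, map_sub, smul_sub]
      abel
    -- Modulo `V_0 + ⋯ + V_n`, both `Hx` and `S` equal `t_(n+1) x`. So the difference lies in two
    -- independent subspaces.
    have hz2 : H x - S ∈ lowerSum (eigenspaces A θ) (n + 1) := by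
      have h1 := apply_sub_smul_mem_lowerSum hH ⟨n + 1, by omega⟩ hx.2
      have h2 : S - lusztigWeight q a d ((n + 1 : ℕ) : ℤ) • x ∈
          lowerSum (eigenspaces A θ) (n + 1) := by
        rw [hS, Finset.sum_range_succ']
        have : c 0 • w 0 = lusztigWeight q a d ((n + 1 : ℕ) : ℤ) • x := rfl
        rw [this, add_sub_cancel_right]
        refine Submodule.sum_mem _ fun k hk => Submodule.smul_mem _ _ ?_
        rw [Finset.mem_range] at hk
        refine lowerSum_mono _ ?_ (h.descend_mem_splitSpace hn (show k + 1 ≤ n + 1 by omega) hx).2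
        omega
      have := sub_mem h1 h2
      simpa using this
    exact sub_eq_zero.1 (h.decomp.disjoint_lowerSum _ hz1 hz2)

/-- `C` plays the role of `B⁻¹`. The operator is bidiagonal on the vectors `w_k`, and the
coefficients of `Hx` were chosen to make it an eigenvector. -/
lemma smul_sub_smul_inv_conjugation (h : RacahSystem q a A As θ θs) (hq : q ≠ 0)
    (hq_root : ∀ n : ℕ, 0 < n → q ^ n ≠ 1) (ha : a ≠ 0) {H C : Module.End F V}
    (hH : ∀ i : Fin (d + 1), ∀ x ∈ eigenspaces A θ i, H x = lusztigWeight q a d i • x)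
    (hHA : ∀ x, H (A x) = A (H x))
    (hC : ∀ n : ℕ, n ≤ d → ∀ x ∈ splitSpace A As θ θs n, C x = (weightScalar q d n)⁻¹ • x)
    {n : ℕ} (hn : n ≤ d) {x : V} (hx : x ∈ splitSpace A As θ θs n) :
    (a • A - a ^ 2 • C) (H x) = weightScalar q d n • H x := by
  rw [h.conjugation_eq_sum hq hq_root ha hH hHA hn hx]
  set τ := racahEigenvalue q a d with hτ
  set c := descentCoeff q a d (n : ℤ) with hc
  set w := fun k => descend A τ (n : ℤ) k x with hw
  have hMw : ∀ k ≤ n, (a • A - a ^ 2 • C) (w k) =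
      weightScalar q d ((n : ℤ) - k) • w k + a • w (k + 1) := by
    intro k hk
    have h1 : A (w k) = τ ((n : ℤ) - k) • w k + w (k + 1) := apply_descend A τ _ k x
    have h2 := hC (n - k) (by omega) (w k) (h.descend_mem_splitSpace hn hk hx)
    rw [LinearMap.sub_apply, LinearMap.smul_apply, LinearMap.smul_apply, h1, h2, Nat.cast_sub hk,
      hτ, racahEigenvalue_eq_weightScalar]
    have := weightScalar_ne_zero (d := d) hq ((n : ℤ) - k)
    match_scalars
    · field_simp; ring
    · ring
  rw [map_sum, Finset.smul_sum, ← sub_eq_zero, ← Finset.sum_sub_distrib]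
  have e1 : ∀ k ∈ Finset.range (n + 1),
      (a • A - a ^ 2 • C) (c k • w k) - weightScalar q d n • c k • w k =
        (c k * a) • w (k + 1) -
          (c k * (weightScalar q d n - weightScalar q d ((n : ℤ) - k))) • w k := by
    intro k hk
    rw [map_smul, hMw k (Nat.lt_succ_iff.1 (Finset.mem_range.1 hk))]
    module
  have hw0 : w (n + 1) = 0 := h.descend_eq_zero hn hx
  -- After shifting one sum by one, the terms cancel in pairs; the boundary terms vanish because
  -- `w_(n+1) = 0` and the diagonal factor is zero at `k = 0`.
  rw [Finset.sum_congr rfl e1, Finset.sum_sub_distrib, Finset.sum_range_succ, Finset.sum_range_succ',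
    hw0, smul_zero, add_zero, Nat.cast_zero, sub_zero, sub_self, mul_zero, zero_smul, add_zero,
    ← Finset.sum_sub_distrib]
  refine Finset.sum_eq_zero fun k _ => ?_
  rw [hc, descentCoeff_succ_mul hq hq_root, sub_self]

end RacahSystem

/-! ### The arrows leaving the eigenspaces of `L(A*)` -/

section Arrows

variable {F : Type*} [Field F] {V : Type*} [AddCommGroup V] [Module F V] {d : ℕ}

lemma IsDecomposition.map_units {W M : Fin (d + 1) → Submodule F V} (hW : IsDecomposition W)
    (H : (Module.End F V)ˣ) (hM : iSupIndep M)
    (hle : ∀ i, ∀ x ∈ W i, (H : Module.End F V) x ∈ M i) :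
    (fun i => (W i).map (H : Module.End F V)) = M ∧ IsDecomposition M := by
  have hinv : ∀ x, (H : Module.End F V) ((↑H⁻¹ : Module.End F V) x) = x := fun x => by
    rw [← Module.End.mul_apply, Units.mul_inv, Module.End.one_apply]
  have hinv' : ∀ x, (↑H⁻¹ : Module.End F V) ((H : Module.End F V) x) = x := fun x => by
    rw [← Module.End.mul_apply, Units.inv_mul, Module.End.one_apply]
  have htop : ⨆ i, (W i).map (H : Module.End F V) = ⊤ := by
    rw [← Submodule.map_iSup, (isDecomposition_iff.1 hW).2.2, Submodule.map_top,
      LinearMap.range_eq_top]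
    exact fun x => ⟨_, hinv x⟩
  have heq := eq_of_le_of_iSup_eq_top hM
    (fun i => Submodule.map_le_iff_le_comap.2 fun x hx => hle i x hx) htop
  refine ⟨heq, isDecomposition_iff.2 ⟨fun i hi => hW.1 i ?_, hM, heq ▸ htop⟩⟩
  rw [← heq] at hi
  refine (Submodule.eq_bot_iff _).2 fun x hx => ?_
  have h0 : (H : Module.End F V) x = 0 :=
    (Submodule.eq_bot_iff _).1 hi _ (Submodule.mem_map_of_mem hx)
  rw [← hinv' x, h0, map_zero]

lemma IsArrow.apply_sub_mem {q : F} {M : Module.End F V} {X Y : Fin (d + 1) → Submodule F V}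
    (h : IsArrow q M X Y) (i : Fin (d + 1)) {x : V} (hx : x ∈ lowerSum X (i + 1)) :
    M x - q ^ ((d : ℤ) - 2 * ((i : ℕ) : ℤ)) • x ∈ lowerSum X i := by
  rw [← sameFlag_iff.1 h.source] at hx ⊢
  exact apply_sub_smul_mem_lowerSum (W := weightSpaces q d M)
    (fun _ _ hy => Module.End.mem_eigenspace_iff.1 hy) i hx

lemma units_inv_apply_of_mem_weightSpaces {q : F} (hq : q ≠ 0) {M : (Module.End F V)ˣ}
    {i : Fin (d + 1)} {x : V} (hx : x ∈ weightSpaces q d (M : Module.End F V) i) :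
    (↑M⁻¹ : Module.End F V) x = (q ^ ((d : ℤ) - 2 * ((i : ℕ) : ℤ)))⁻¹ • x := by
  have h1 : (M : Module.End F V) x = q ^ ((d : ℤ) - 2 * ((i : ℕ) : ℤ)) • x :=
    Module.End.mem_eigenspace_iff.1 hx
  have h2 : (↑M⁻¹ : Module.End F V) ((M : Module.End F V) x) = x := by
    rw [← Module.End.mul_apply, Units.inv_mul, Module.End.one_apply]
  rw [h1, map_smul] at h2
  rw [eq_inv_smul_iff₀ (zpow_ne_zero _ hq), h2]

lemma IsArrow.inv_apply_sub_mem {q : F} (hq : q ≠ 0) {M : (Module.End F V)ˣ}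
    {X Y : Fin (d + 1) → Submodule F V}
    (h : IsArrow q (M : Module.End F V) X Y) (i : Fin (d + 1)) {x : V}
    (hx : x ∈ lowerSum X (i + 1)) :
    (↑M⁻¹ : Module.End F V) x - (q ^ ((d : ℤ) - 2 * ((i : ℕ) : ℤ)))⁻¹ • x ∈ lowerSum X i := by
  rw [← sameFlag_iff.1 h.source] at hx ⊢
  exact apply_sub_smul_mem_lowerSum (W := weightSpaces q d (M : Module.End F V))
    (c := fun i => (q ^ ((d : ℤ) - 2 * ((i : ℕ) : ℤ)))⁻¹)
    (fun _ _ hy => units_inv_apply_of_mem_weightSpaces hq hy) i hx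

lemma inversion_weightSpaces (q : F) (M : Module.End F V) :
    inversion (weightSpaces q d M) =
      fun i : Fin (d + 1) => M.eigenspace (q ^ ((d : ℤ) - 2 * ((i : ℕ) : ℤ)))⁻¹ := by
  funext i
  have : (d : ℤ) - 2 * ((i.rev : ℕ) : ℤ) = -((d : ℤ) - 2 * ((i : ℕ) : ℤ)) := by
    rw [Fin.val_rev]; omega
  rw [inversion, weightSpaces, this, zpow_neg]

/-- The normalised weights sum to 1, so two operators with the same diagonal entry `c` combine to
one with entry `c`. -/
lemma smul_weighted_difference {a : F} (ha : a⁻¹ - a ≠ 0) (c : F) (u v x : V) :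
    (a⁻¹ - a)⁻¹ • (a⁻¹ • (u - c • x) - a • (v - c • x)) =
      (a⁻¹ - a)⁻¹ • (a⁻¹ • u - a • v) - c • x := by
  have h : (a⁻¹ - a)⁻¹ • (a⁻¹ • (u - c • x) - a • (v - c • x)) =
      (a⁻¹ - a)⁻¹ • (a⁻¹ • u - a • v) - ((a⁻¹ - a)⁻¹ * (a⁻¹ - a)) • c • x := by module
  rw [h, inv_mul_cancel₀ ha, one_smul]

namespace RacahSystem

variable {q a : F} {A As : Module.End F V} {θ θs : Fin (d + 1) → F}

lemma isDecomposition_lusztigOp (h : RacahSystem q a A As θ θs) (hq : q ≠ 0)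
    (hq_root : ∀ n : ℕ, 0 < n → q ^ n ≠ 1) (ha : a ≠ 0) :
    IsDecomposition (eigenspaces (lusztigOp q A As) θs) := by
  obtain ⟨H, -, -, hHL⟩ := h.exists_lusztig_conjugation hq hq_root ha
  refine (h.decomp_star.map_units H (iSupIndep_eigenspace _ h.injective_star)
    fun i x hx => Module.End.mem_eigenspace_iff.2 ?_).2
  have hx' : As x = θs i • x := Module.End.mem_eigenspace_iff.1 hx
  rw [← hHL, hx', map_smul]

/-- `H` maps the weight spaces of `B` to those of the new operator, `V*_i` to `V+_i`, and each `V_i`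
to itself, so both flag conditions are transported from `B`. -/
lemma isArrow_lusztigOp (h : RacahSystem q a A As θ θs) (hq : q ≠ 0)
    (hq_root : ∀ n : ℕ, 0 < n → q ^ n ≠ 1) (ha : a ≠ 0) {B : (Module.End F V)ˣ}
    (hB : IsArrow q (B : Module.End F V) (eigenspaces As θs) (eigenspaces A θ)) :
    IsArrow q (a • A - a ^ 2 • (↑B⁻¹ : Module.End F V))
      (eigenspaces (lusztigOp q A As) θs) (eigenspaces A θ) := by
  obtain ⟨H, hH, hHA, hHL⟩ := h.exists_lusztig_conjugation hq hq_root ha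
  -- The indexing reverses: the weight `q^(d-2i)` of `B` is `s_n` for `n = d - i`.
  have hsplit : ∀ i : Fin (d + 1), weightSpaces q d (B : Module.End F V) i =
      splitSpace A As θ θs (d - i) := fun i => by
    rw [hB.weightSpaces_eq, splitSpace, show d + 1 - (d - (i : ℕ)) = i + 1 by omega,
      show d - (i : ℕ) + 1 = d + 1 - i by omega]
  have hwt : ∀ i : Fin (d + 1),
      weightScalar q d ((d - (i : ℕ) : ℕ) : ℤ) = q ^ ((d : ℤ) - 2 * ((i : ℕ) : ℤ)) := fun i => by
    rw [weightScalar, Nat.cast_sub (by omega)]; congr 1; ring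
  have hC : ∀ n : ℕ, n ≤ d → ∀ x ∈ splitSpace A As θ θs n,
      (↑B⁻¹ : Module.End F V) x = (weightScalar q d n)⁻¹ • x := by
    intro n hn x hx
    have h1 := hsplit ⟨d - n, by omega⟩
    have h2 := hwt ⟨d - n, by omega⟩
    simp only [Nat.sub_sub_self hn] at h1 h2
    rw [h2]
    exact units_inv_apply_of_mem_weightSpaces hq (h1 ▸ hx)
  obtain ⟨e1, hdec⟩ := hB.decomposition.map_units H
    (iSupIndep_eigenspace (a • A - a ^ 2 • (↑B⁻¹ : Module.End F V)) (weight_injective hq hq_root d))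
    fun i x hx => Module.End.mem_eigenspace_iff.2 (by
      rw [← hwt]
      exact h.smul_sub_smul_inv_conjugation hq hq_root ha hH hHA hC (by omega) (hsplit i ▸ hx))
  obtain ⟨e2, -⟩ := h.decomp_star.map_units H
    (iSupIndep_eigenspace (lusztigOp q A As) h.injective_star)
    fun i x hx => Module.End.mem_eigenspace_iff.2 (by
      have hx' : As x = θs i • x := Module.End.mem_eigenspace_iff.1 hx
      rw [← hHL, hx', map_smul])
  obtain ⟨e3, -⟩ := h.decomp.map_units H (isDecomposition_iff.1 h.decomp).2.1
    fun i x hx => by rw [hH i x hx]; exact Submodule.smul_mem _ _ hx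
  refine ⟨hdec, sameFlag_iff.2 fun k => ?_, sameFlag_iff.2 fun k => ?_⟩
  · change lowerSum (fun i : Fin (d + 1) => Module.End.eigenspace _ _) k =
      lowerSum (fun i => Module.End.eigenspace _ _) k
    rw [← e1, ← e2, lowerSum_map, lowerSum_map, sameFlag_iff.1 hB.source]
  · rw [← e3, lowerSum_map, ← sameFlag_iff.1 hB.target, ← lowerSum_map]
    congr 1
    funext i
    exact (congrFun e1 i.rev).symm

/-- The vertical arrow from `L(A*)` to `A*`. -/
lemma isArrow_vertical (h : RacahSystem q a A As θ θs) (hq : q ≠ 0)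
    (hq_root : ∀ n : ℕ, 0 < n → q ^ n ≠ 1) (ha : a ≠ 0) (ha' : a⁻¹ - a ≠ 0)
    {K B : (Module.End F V)ˣ}
    (hK : IsArrow q (K : Module.End F V) (eigenspaces As θs) (inversion (eigenspaces A θ)))
    (hB : IsArrow q (B : Module.End F V) (eigenspaces As θs) (eigenspaces A θ)) :
    IsArrow q ((a⁻¹ - a)⁻¹ •
        (a⁻¹ • (↑K⁻¹ : Module.End F V) - a • (↑B⁻¹ : Module.End F V)))
      (eigenspaces (lusztigOp q A As) θs) (eigenspaces As θs) := by
  set N := (a⁻¹ - a)⁻¹ • (a⁻¹ • (↑K⁻¹ : Module.End F V) - a • (↑B⁻¹ : Module.End F V)) with hN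
  have hK' := h.flip.isArrow_lusztigOp hq hq_root (inv_ne_zero ha) hK
  have hB' := h.isArrow_lusztigOp hq hq_root ha hB
  -- Rewritten through the two arrows out of `V+`, the multiples of `A` cancelling. This form
  -- controls the source flag, the original one the target flag.
  have hN' : N = (a⁻¹ - a)⁻¹ • (a⁻¹ • (a • A - a ^ 2 • (↑B⁻¹ : Module.End F V)) -
      a • (a⁻¹ • A - a⁻¹ ^ 2 • (↑K⁻¹ : Module.End F V))) := by
    rw [hN]
    congr 1
    match_scalars <;> field_simp <;> ring
  have hwt := weight_injective hq hq_root d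
  obtain ⟨hdec, hsrc⟩ := triangular (h.isDecomposition_lusztigOp hq hq_root ha) hwt (M := N)
    (fun i x hx => by
      have h1 := hK'.apply_sub_mem i hx
      have h2 := hB'.apply_sub_mem i hx
      have h3 := Submodule.smul_mem _ (a⁻¹ - a)⁻¹
        (sub_mem (Submodule.smul_mem _ a⁻¹ h2) (Submodule.smul_mem _ a h1))
      rw [smul_weighted_difference ha'] at h3
      rw [hN']
      exact h3)
  obtain ⟨-, htgt⟩ := triangular h.decomp_star (M := N)
    (μ := fun i : Fin (d + 1) => (q ^ ((d : ℤ) - 2 * ((i : ℕ) : ℤ)))⁻¹)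
    (fun i j hij => hwt (inv_injective hij))
    (fun i x hx => by
      have h1 := hK.inv_apply_sub_mem hq i hx
      have h2 := hB.inv_apply_sub_mem hq i hx
      have h3 := Submodule.smul_mem _ (a⁻¹ - a)⁻¹
        (sub_mem (Submodule.smul_mem _ a⁻¹ h1) (Submodule.smul_mem _ a h2))
      rw [smul_weighted_difference ha'] at h3
      rw [hN]
      exact h3)
  refine ⟨hdec, sameFlag_iff.2 hsrc, sameFlag_iff.2 fun k => ?_⟩
  rw [inversion_weightSpaces]
  exact htgt k

/-- If `a = a⁻¹`, then the closed form gives `θ_0 = θ_d`. -/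
lemma inv_sub_ne_zero (h : RacahSystem q a A As θ θs)
    (hd : 1 ≤ d) (hinj : Function.Injective θ) : a⁻¹ - a ≠ 0 := by
  intro h0
  have h1 : θ 0 = θ (Fin.last d) := by
    rw [h.form, h.form, racahEigenvalue, racahEigenvalue, Fin.val_last, Fin.val_zero,
      sub_eq_zero.1 h0, add_comm]
    congr 3 <;> push_cast <;> ring
  have := congrArg Fin.val (hinj h1)
  simp only [Fin.val_zero, Fin.val_last] at this
  omega

end RacahSystem

end Arrows

/-! ### From modules over the algebra to pairs of operators -/

section Modules

variable {F : Type*} [Field F] {q : F} {V : Type*} [AddCommGroup V] [Module F V]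
  [Module (QOnsager F q) V] [IsScalarTower F (QOnsager F q) V]

lemma act_lusztigAstar :
    act V (lusztigAstar F q) = lusztigOp q (act V (genA F q)) (act V (genAstar F q)) := by
  simp only [act, lusztigAstar, lusztigOp, bracket, qBracket, map_add, map_sub, map_mul, map_smul]

lemma dolanGradyRel_act : DolanGradyRel q (act V (genA F q)) (act V (genAstar F q)) := by
  have h := congrArg (act V) (RingQuot.mkAlgHom_rel F (DolanGrady.rel_one (F := F) (q := q)))
  simpa only [DolanGradyRel, act, genA, genAstar, bracket, qBracket, map_sub, map_mul, map_smul]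
    using h

lemma dolanGradyRel_act_symm :
    DolanGradyRel q (act V (genAstar F q)) (act V (genA F q)) := by
  have h := congrArg (act V) (RingQuot.mkAlgHom_rel F (DolanGrady.rel_two (F := F) (q := q)))
  simpa only [DolanGradyRel, act, genA, genAstar, bracket, qBracket, map_sub, map_mul, map_smul]
    using h

lemma smul_mem_of_invariant {p : Submodule F V} (hA : ∀ x ∈ p, act V (genA F q) x ∈ p)
    (hAs : ∀ x ∈ p, act V (genAstar F q) x ∈ p) (r : QOnsager F q) : ∀ x ∈ p, r • x ∈ p := by
  obtain ⟨y, rfl⟩ := RingQuot.mkAlgHom_surjective F (DolanGrady F q) r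
  induction y using FreeAlgebra.induction with
  | grade0 c =>
    intro x hx
    rw [AlgHom.commutes, algebraMap_smul]
    exact Submodule.smul_mem _ _ hx
  | grade1 g =>
    cases g
    · exact hA
    · exact hAs
  | mul a b ha hb =>
    intro x hx
    rw [map_mul, mul_smul]
    exact ha _ (hb x hx)
  | add a b ha hb =>
    intro x hx
    rw [map_add, add_smul]
    exact add_mem (ha x hx) (hb x hx)

lemma irreduciblePair_act [IsSimpleModule (QOnsager F q) V] :
    IrreduciblePair (act V (genA F q)) (act V (genAstar F q)) := by
  intro p hA hAs
  let P : Submodule (QOnsager F q) V :=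
    { p.toAddSubmonoid with smul_mem' := fun r x hx => smul_mem_of_invariant hA hAs r x hx }
  have hP : ∀ x, x ∈ P ↔ x ∈ p := fun _ => Iff.rfl
  rcases eq_bot_or_eq_top P with h | h
  · left
    refine (Submodule.eq_bot_iff _).2 fun x hx => ?_
    rw [← hP, h] at hx
    simpa using hx
  · right
    refine Submodule.eq_top_iff'.2 fun x => ?_
    rw [← hP, h]; trivial

end Modules

end QOns

/-! ### Assembly of the theorem -/

open QOns in
theorem theorem8p1 {F : Type*} [Field F] (q : F) (hq : q ≠ 0)
    (hq_root : ∀ n : ℕ, 0 < n → q ^ n ≠ 1)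
    {V : Type*} [AddCommGroup V] [Module F V] [Module (QOnsager F q) V]
    [IsScalarTower F (QOnsager F q) V] [IsSimpleModule (QOnsager F q) V]
    [FiniteDimensional F V] (hV : 2 ≤ Module.finrank F V)
    (A As LAs : Module.End F V)
    (hA : A = act V (genA F q)) (hAs : As = act V (genAstar F q))
    (hLAs : LAs = act V (lusztigAstar F q))
    (hA_diag : Diagonalizable A) (hAs_diag : Diagonalizable As) :
    ∃ d : ℕ, 1 ≤ d ∧
      -- the orderings of the eigenvalues of `A` and of `A*` that the diagram refers to exist
      (∃ θ : Fin (d + 1) → F, IsEigenvalueOrdering A θ ∧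
        ∀ i : Fin d, Adjacent q (θ i.castSucc) (θ i.succ)) ∧
      (∃ θs : Fin (d + 1) → F, IsEigenvalueOrdering As θs ∧ ThreeTerm A (eigenspaces As θs)) ∧
      -- and for each choice of them the following holds
      ∀ θ θs : Fin (d + 1) → F,
        IsEigenvalueOrdering A θ → (∀ i : Fin d, Adjacent q (θ i.castSucc) (θ i.succ)) →
        IsEigenvalueOrdering As θs → ThreeTerm A (eigenspaces As θs) →
        -- the scalar `a` exists
        (∃ a : F, a ≠ 0 ∧ ∀ i : Fin (d + 1), θ i =
          a * q ^ ((d : ℤ) - 2 * ((i : ℕ) : ℤ)) + a⁻¹ * q ^ (2 * ((i : ℕ) : ℤ) - (d : ℤ))) ∧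
        -- the three horizontal segments are decompositions of `V`
        IsDecomposition (eigenspaces A θ) ∧
        IsDecomposition (eigenspaces As θs) ∧
        IsDecomposition (eigenspaces LAs θs) ∧
        -- the maps `K`, `B`, `K↓`, `B↓` exist and are uniquely determined
        (∃! K : (Module.End F V)ˣ,
          IsArrow q (K : Module.End F V) (eigenspaces As θs) (inversion (eigenspaces A θ))) ∧
        (∃! B : (Module.End F V)ˣ,
          IsArrow q (B : Module.End F V) (eigenspaces As θs) (eigenspaces A θ)) ∧
        (∃! Kd : (Module.End F V)ˣ,
          IsArrow q (Kd : Module.End F V) (inversion (eigenspaces As θs))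
            (inversion (eigenspaces A θ))) ∧
        (∃! Bd : (Module.End F V)ˣ,
          IsArrow q (Bd : Module.End F V) (inversion (eigenspaces As θs)) (eigenspaces A θ)) ∧
        ∀ a : F, a ≠ 0 → (∀ i : Fin (d + 1), θ i =
          a * q ^ ((d : ℤ) - 2 * ((i : ℕ) : ℤ)) + a⁻¹ * q ^ (2 * ((i : ℕ) : ℤ) - (d : ℤ))) →
        ∀ K B Kd Bd : (Module.End F V)ˣ,
          IsArrow q (K : Module.End F V) (eigenspaces As θs) (inversion (eigenspaces A θ)) →
          IsArrow q (B : Module.End F V) (eigenspaces As θs) (eigenspaces A θ) →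
          IsArrow q (Kd : Module.End F V) (inversion (eigenspaces As θs))
            (inversion (eigenspaces A θ)) →
          IsArrow q (Bd : Module.End F V) (inversion (eigenspaces As θs)) (eigenspaces A θ) →
          -- the four arrows between `L(A*)` and `A`
          IsArrow q (a • A - a ^ 2 • (↑B⁻¹ : Module.End F V))
            (eigenspaces LAs θs) (eigenspaces A θ) ∧
          IsArrow q (a⁻¹ • A - a⁻¹ ^ 2 • (↑K⁻¹ : Module.End F V))
            (eigenspaces LAs θs) (inversion (eigenspaces A θ)) ∧
          IsArrow q (a • A - a ^ 2 • (↑Bd⁻¹ : Module.End F V))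
            (inversion (eigenspaces LAs θs)) (eigenspaces A θ) ∧
          IsArrow q (a⁻¹ • A - a⁻¹ ^ 2 • (↑Kd⁻¹ : Module.End F V))
            (inversion (eigenspaces LAs θs)) (inversion (eigenspaces A θ)) ∧
          -- the two vertical arrows from `L(A*)` to `A*`
          a⁻¹ - a ≠ 0 ∧
          IsArrow q ((a⁻¹ - a)⁻¹ •
              (a⁻¹ • (↑K⁻¹ : Module.End F V) - a • (↑B⁻¹ : Module.End F V)))
            (eigenspaces LAs θs) (eigenspaces As θs) ∧
          IsArrow q ((a⁻¹ - a)⁻¹ •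
              (a⁻¹ • (↑Kd⁻¹ : Module.End F V) - a • (↑Bd⁻¹ : Module.End F V)))
            (inversion (eigenspaces LAs θs)) (inversion (eigenspaces As θs)) := by
  have hAs_rel : DolanGradyRel q A As := by rw [hA, hAs]; exact dolanGradyRel_act
  have hAs_rel' : DolanGradyRel q As A := by rw [hA, hAs]; exact dolanGradyRel_act_symm
  have hirr : IrreduciblePair A As := by rw [hA, hAs]; exact irreduciblePair_act
  have hL : LAs = lusztigOp q A As := by rw [hLAs, hA, hAs]; exact act_lusztigAstar
  obtain ⟨d, hd, θ₀, hθ₀, hadj₀⟩ := exists_eigenvalueOrdering hq hAs_rel hirr hA_diag hAs_diag hV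
  obtain ⟨δ, hδ, θs₀, hθs₀, hadjs₀⟩ :=
    exists_eigenvalueOrdering hq hAs_rel' hirr.symm hAs_diag hA_diag hV
  obtain ⟨a₀, ha₀, hform₀⟩ := exists_racahEigenvalue hq hq_root hd hθ₀.1 hadj₀
  obtain ⟨b₀, hb₀, hforms₀⟩ := exists_racahEigenvalue hq hq_root hδ hθs₀.1 hadjs₀
  have hthree₀ : ThreeTerm A (eigenspaces As θs₀) :=
    threeTerm_of_dolanGradyRel hq hq_root hAs_rel' hAs_diag hθs₀ hb₀ hforms₀
  have hflag := flagPair_of_threeTerm hthree₀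
    (threeTerm_of_dolanGradyRel hq hq_root hAs_rel hA_diag hθ₀ ha₀ hform₀)
  have hdec := isDecomposition_eigenspaces hA_diag hθ₀
  have hdecs := isDecomposition_eigenspaces hAs_diag hθs₀
  have hbot : ∀ {n : ℕ} {W : Fin (n + 1) → Submodule F V}, IsDecomposition W → lowerSum W 1 ≠ ⊥ :=
    fun hW => (hW.lowerSum_lt (Nat.succ_pos _)).ne_bot
  -- `A` and `A*` have equally many eigenvalues: `length_le` is applied to the flag pair and to its
  -- mirror image.
  have hδd : δ = d := le_antisymm
    (hflag.symm.length_le hirr.symm (hdec.lowerSum_eq_top le_rfl)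
      (hdecs.lowerSum_lt (Nat.lt_succ_self _)).ne_top (hbot hdecs))
    (hflag.length_le hirr (hdecs.lowerSum_eq_top le_rfl)
      (hdec.lowerSum_lt (Nat.lt_succ_self _)).ne_top (hbot hdec))
  subst hδd
  refine ⟨δ, hd, ⟨θ₀, hθ₀, hadj₀⟩, ⟨θs₀, hθs₀, hthree₀⟩, ?_⟩
  intro θ θs hθ hadj hθs hthree
  obtain ⟨a₁, ha₁, hform₁⟩ := exists_racahEigenvalue hq hq_root hd hθ.1 hadj
  have hsys : ∀ a : F, a ≠ 0 → (∀ i : Fin (δ + 1), θ i = racahEigenvalue q a δ i) →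
      RacahSystem q a A As θ θs := fun a ha hform =>
    ⟨isDecomposition_eigenspaces hA_diag hθ, isDecomposition_eigenspaces hAs_diag hθs, hθs.1, hform,
      hthree, threeTerm_of_dolanGradyRel hq hq_root hAs_rel hA_diag hθ ha hform⟩
  have h₁ := hsys a₁ ha₁ hform₁
  have hunique : ∀ {b : F} {η ηs : Fin (δ + 1) → F}, RacahSystem q b A As η ηs →
      ∃! M : (Module.End F V)ˣ,
        IsArrow q (M : Module.End F V) (eigenspaces As ηs) (eigenspaces A η) := fun h =>
    existsUnique_isArrow hq hq_root (flagPair_of_threeTerm h.threeTerm h.threeTerm_star) hirr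
      h.decomp_star h.decomp
  subst hL
  refine ⟨⟨a₁, ha₁, hform₁⟩, h₁.decomp, h₁.decomp_star, h₁.isDecomposition_lusztigOp hq hq_root ha₁,
    hunique h₁.flip, hunique h₁, hunique h₁.flip.flip_star, hunique h₁.flip_star, ?_⟩
  intro a ha hform K B Kd Bd hK hB hKd hBd
  have h := hsys a ha hform
  have ha' := h.inv_sub_ne_zero hd hθ.1
  exact ⟨h.isArrow_lusztigOp hq hq_root ha hB,
    h.flip.isArrow_lusztigOp hq hq_root (inv_ne_zero ha) hK,
    h.flip_star.isArrow_lusztigOp hq hq_root ha hBd,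
    h.flip_star.flip.isArrow_lusztigOp hq hq_root (inv_ne_zero ha) hKd,
    ha',
    h.isArrow_vertical hq hq_root ha ha' hK hB,
    h.flip_star.isArrow_vertical hq hq_root ha ha' hKd hBd⟩
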